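/- **Theorem 1.3.** Let $\mathbb T^2=(\mathbb S^1\times\mathbb S^1,\,d\gamma^2+d\vartheta^2)$ be the flat torus with angular coordinates $\gamma,\vartheta\in\mathbb R/2\pi\mathbb Z$, and let $\mathbb S^2\subset\mathbb R^3$ be the unit sphere. For a smooth map $\varphi:\mathbb T^2\to\mathbb S^2$ let $\mathcal C(\varphi^{-1}T\mathbb S^2)$ be the real vector space of smooth sections of the pull-back bundle, $\nabla^\varphi$ the connection induced on it by the Levi-Civita connection of $\mathbb S^2$, $\tau(\varphi)=\operatorname{trace}\nabla d\varphi$ the tension field and $\overline\Delta=-\operatorname{trace}(\nabla^\varphi)^2$ the rough Laplacian. With respect to the parallel orthonormal frame $e_1=\partial_\gamma$, $e_2=\partial_\vartheta$, the latter is $\overline\Delta V=-\sum_i\nabla^\varphi_{e_i}\nabla^\varphi_{e_i}V$. Write $dV$ and $d\tau(\varphi)$ for the one-forms $X\mapsto\nabla^\varphi_XV$ and $X\mapsto\nabla^\varphi_X\tau(\varphi)$; "trace" and the scalar products of one-forms are sums over $e_1,e_2$. Let $I_2:\mathcal C(\varphi^{-1}T\mathbb S^2)\to\mathcal C(\varphi^{-1}T\mathbb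 S^2)$ be the iterated Jacobi operator (the operator of the second variation of the bienergy $\frac12\int|\tau(\varphi)|^2$), which for maps into a unit sphere is explicitly $$\begin{aligned} I_2(V)={}&\overline\Delta^2V+\overline\Delta\big(\operatorname{trace}\langle V,d\varphi\cdot\rangle d\varphi\cdot-|d\varphi|^2V\big)+2\langle d\tau(\varphi),d\varphi\rangle V+|\tau(\varphi)|^2V\\ &-2\operatorname{trace}\langle V,d\tau(\varphi)\cdot\rangle d\varphi\cdot-2\operatorname{trace}\langle\tau(\varphi),dV\cdot\rangle d\varphi\cdot-\langle\tau(\varphi),V\rangle\tau(\varphi)\\ &+\operatorname{trace}\langle d\varphi\cdot,\overline\Delta V\rangle d\varphi\cdot+\operatorname{trace}\langle d\varphi\cdot,(\operatorname{trace}\langle V,d\varphi\cdot\rangle d\varphi\cdot)\rangle d\varphi\cdot-2|d\varphi|^2\operatorname{trace}\langle d\varphi\cdot,V\rangle d\varphi\cdot\\ &+2\langle dV,d\varphi\rangle\tau(\varphi)-|d\varphi|^2\,\overline\Delta V+|d\varphi|^4V . \end{aligned}$$ Let $\mathrm{Nullity}(\varphi)=\dim\{V\in\mathcal C(\varphi^{-1}T\mathbb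 S^2): I_2(V)=0\}$ and let $\mathrm{Index}(\varphi)$ be the sum of the dimensions of the eigenspaces of $I_2$ over all its negative eigenvalues. For an integer $k\ge1$ let $\varphi_k:\mathbb T^2\to\mathbb S^2$ be the map $$\varphi_k(\gamma,\vartheta)=\big(\sin\alpha^*\cos(k\gamma),\ \sin\alpha^*\sin(k\gamma),\ \cos\alpha^*\big),\qquad \alpha^*=\tfrac{\pi}{4},$$ and for integers $m,n\ge1$ put $$\lambda^-_{m,n}=\tfrac12\Big(-k^4+k^2(5m^2+n^2)+2(m^2+n^2)^2-\sqrt{k^8+2k^6(m^2+n^2)+k^4(m^2+n^2)^2+32k^2m^2(m^2+n^2)^2}\Big).$$ Let $f(k)$ and $g(k)$ be the numbers of pairs of integers $m,n\ge1$ with $\lambda^-_{m,n}<0$ and with $\lambda^-_{m,n}=0$, respectively. Then $$\mathrm{Nullity}(\varphi_k)=5+4\,g(k),\qquad \mathrm{Index}(\varphi_k)=1+4(k-1)+4\,f(k);$$ in particular both are finite. -/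

import Mathlib

open scoped ContDiff InnerProductSpace

noncomputable section

namespace Biharmonic

/-- The ambient Euclidean space `ℝ³` of the sphere. -/
abbrev E3 : Type := EuclideanSpace ℝ (Fin 3)

/-- The unit sphere `𝕊² ⊆ ℝ³`. -/
abbrev S2 : Type := Metric.sphere (0 : E3) 1

/-- The torus `𝕋² = 𝕊¹ × 𝕊¹`, with angular coordinates `(γ, ϑ)`, each taken modulo `2π`. -/
abbrev Torus : Type := Real.Angle × Real.Angle

/-- The universal covering `ℝ² → 𝕋²`. -/
def cover (x : ℝ × ℝ) : Torus := ((x.1 : Real.Angle), (x.2 : Real.Angle))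

/-- A function on the torus is smooth if its (doubly periodic) lift to `ℝ²` is smooth. -/
def TorusSmooth {F : Type*} [NormedAddCommGroup F] [NormedSpace ℝ F] (f : Torus → F) : Prop :=
  ContDiff ℝ ∞ (fun x : ℝ × ℝ => f (cover x))

/-- The two coordinate directions of `ℝ²`. -/
def dir (i : Fin 2) : ℝ × ℝ := ![(1, 0), (0, 1)] i

/-- The derivative of a vector-valued function on the torus along the coordinate field
`e₀ = ∂/∂γ` or `e₁ = ∂/∂ϑ`. These two fields form a global orthonormal frame of the flat metric
`dγ² + dϑ²`, and they are parallel. -/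
def partialD {F : Type*} [NormedAddCommGroup F] [NormedSpace ℝ F] (i : Fin 2) (f : Torus → F) :
    Torus → F :=
  fun p => deriv (fun s : ℝ => f (p + cover (s • dir i))) 0

/-- Smooth maps `𝕋² → 𝕊²`. -/
structure SmoothMap where
  /-- the underlying map -/
  toFun : Torus → S2
  smooth' : TorusSmooth (fun p => (toFun p : E3))

/-- The map `φ`, seen as a map to `ℝ³`. -/
def SmoothMap.vec (φ : SmoothMap) : Torus → E3 := fun p => (φ.toFun p : E3)

/-- The pointwise scalar product of two `ℝ³`-valued functions. -/
def ip (A B : Torus → E3) : Torus → ℝ := fun p => ⟪A p, B p⟫_ℝ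

/-- The space `𝒞(φ⁻¹T𝕊²)` of smooth sections of the pull-back bundle: smooth `V : 𝕋² → ℝ³` with
`V(p) ∈ T_{φ(p)}𝕊²`, i.e. `V(p) ⟂ φ(p)`. -/
def IsSection (φ : SmoothMap) (V : Torus → E3) : Prop :=
  TorusSmooth V ∧ ∀ p, ip V φ.vec p = 0

/-- The orthogonal projection of an `ℝ³`-valued function along `φ` to `φ⁻¹T𝕊²`. -/
def tangential (φ : SmoothMap) (V : Torus → E3) : Torus → E3 := V - ip V φ.vec • φ.vec

/-- The connection `∇^φ` induced on `φ⁻¹T𝕊²` by the Levi-Civita connection of the round sphere, in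
the direction `e_i`: differentiate in `ℝ³` and project to the tangent plane of the sphere. -/
def nabla (φ : SmoothMap) (i : Fin 2) (V : Torus → E3) : Torus → E3 :=
  tangential φ (partialD i V)

/-- The differential: `dmap φ i = dφ(e_i)`. -/
def dmap (φ : SmoothMap) (i : Fin 2) : Torus → E3 := partialD i φ.vec

/-- The rough Laplacian `Δ̄ = -∑ ∇_{e_i} ∇_{e_i}`
(the correction terms vanish because the `e_i` are parallel). -/
def roughLaplacian (φ : SmoothMap) (V : Torus → E3) : Torus → E3 :=
  -∑ i, nabla φ i (nabla φ i V)

/-- The tension field `τ(φ) = trace ∇dφ`. -/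
def tension (φ : SmoothMap) : Torus → E3 := ∑ i, nabla φ i (dmap φ i)

/-- `⟨A, B⟩ = ∑ ⟨A(e_i), B(e_i)⟩`. -/
def ipForm (A B : Fin 2 → Torus → E3) : Torus → ℝ := ∑ i, ip (A i) (B i)

/-- `trace ⟨A ·, B ·⟩ C · = ∑ ⟨A(e_i), B(e_i)⟩ C(e_i)`. -/
def traceForm (A B C : Fin 2 → Torus → E3) : Torus → E3 := ∑ i, ip (A i) (B i) • C i

/-- `d V` for a section `V`, the one-form `e_i ↦ ∇_{e_i} V`. -/
def dsec (φ : SmoothMap) (V : Torus → E3) : Fin 2 → Torus → E3 := fun i => nabla φ i V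

/-- The constant family `e_i ↦ V`, for the slots of a trace that do not depend on `e_i`. -/
def cst (V : Torus → E3) : Fin 2 → Torus → E3 := fun _ => V

/-- The explicit expression of the iterated Jacobi operator `I₂(V)`, the operator of the second
variation of the bienergy, for maps to a round unit sphere. -/
def jacobiField (φ : SmoothMap) (V : Torus → E3) : Torus → E3 :=
  roughLaplacian φ (roughLaplacian φ V)
  + roughLaplacian φ
      (traceForm (cst V) (dmap φ) (dmap φ) - ipForm (dmap φ) (dmap φ) • V)
  + (2 : ℝ) • (ipForm (dsec φ (tension φ)) (dmap φ) • V)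
  + ip (tension φ) (tension φ) • V
  - (2 : ℝ) • traceForm (cst V) (dsec φ (tension φ)) (dmap φ)
  - (2 : ℝ) • traceForm (cst (tension φ)) (dsec φ V) (dmap φ)
  - ip (tension φ) V • tension φ
  + traceForm (dmap φ) (cst (roughLaplacian φ V)) (dmap φ)
  + traceForm (dmap φ) (cst (traceForm (cst V) (dmap φ) (dmap φ))) (dmap φ)
  - (2 : ℝ) • (ipForm (dmap φ) (dmap φ) • traceForm (dmap φ) (cst V) (dmap φ))
  + (2 : ℝ) • (ipForm (dsec φ V) (dmap φ) • tension φ)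
  - ipForm (dmap φ) (dmap φ) • roughLaplacian φ V
  + (ipForm (dmap φ) (dmap φ)) ^ 2 • V

section smoothness

variable {F : Type*} [NormedAddCommGroup F] [NormedSpace ℝ F]

theorem cover_add (x y : ℝ × ℝ) : cover (x + y) = cover x + cover y := rfl

theorem exists_cover (p : Torus) : ∃ x, cover x = p := by
  obtain ⟨a, b⟩ := p
  induction a using Real.Angle.induction_on
  induction b using Real.Angle.induction_on
  exact ⟨(_, _), rfl⟩

theorem TorusSmooth.hasDerivAt {f : Torus → F} (hf : TorusSmooth f) (i : Fin 2) (x : ℝ × ℝ) :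
    HasDerivAt (fun s : ℝ => f (cover x + cover (s • dir i)))
      (fderiv ℝ (fun y => f (cover y)) x (dir i)) 0 := by
  have h1 : HasFDerivAt (fun y => f (cover y)) (fderiv ℝ (fun y => f (cover y)) x)
      (x + (0 : ℝ) • dir i) := by
    rw [zero_smul, add_zero]
    exact ((ContDiff.differentiable hf (by simp)) x).hasFDerivAt
  have h2 : HasDerivAt (fun s : ℝ => x + s • dir i) (dir i) 0 := by
    simpa using ((hasDerivAt_id (0 : ℝ)).smul_const (dir i)).const_add x
  exact h1.comp_hasDerivAt (0 : ℝ) h2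

theorem TorusSmooth.partialD_cover {f : Torus → F} (hf : TorusSmooth f) (i : Fin 2)
    (x : ℝ × ℝ) :
    partialD i f (cover x) = fderiv ℝ (fun y => f (cover y)) x (dir i) :=
  (hf.hasDerivAt i x).deriv

theorem TorusSmooth.partialD {f : Torus → F} (hf : TorusSmooth f) (i : Fin 2) :
    TorusSmooth (partialD i f) := by
  unfold TorusSmooth
  simp_rw [hf.partialD_cover i]
  exact (ContDiff.fderiv_right hf (m := ∞) (by simp)).clm_apply contDiff_const

theorem TorusSmooth.add {f g : Torus → F} (hf : TorusSmooth f) (hg : TorusSmooth g) :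
    TorusSmooth (f + g) := ContDiff.add hf hg

theorem TorusSmooth.sub {f g : Torus → F} (hf : TorusSmooth f) (hg : TorusSmooth g) :
    TorusSmooth (f - g) := ContDiff.sub hf hg

theorem TorusSmooth.neg {f : Torus → F} (hf : TorusSmooth f) : TorusSmooth (-f) :=
  ContDiff.neg hf

theorem TorusSmooth.smul {c : Torus → ℝ} {f : Torus → F} (hc : TorusSmooth c)
    (hf : TorusSmooth f) : TorusSmooth (c • f) := ContDiff.smul hc hf

theorem TorusSmooth.const_smul {f : Torus → F} (c : ℝ) (hf : TorusSmooth f) :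
    TorusSmooth (c • f) := ContDiff.const_smul c hf

theorem TorusSmooth.sq {c : Torus → ℝ} (hc : TorusSmooth c) : TorusSmooth (c ^ 2) :=
  ContDiff.pow hc 2

theorem TorusSmooth.sum {f : Fin 2 → Torus → F} (hf : ∀ i, TorusSmooth (f i)) :
    TorusSmooth (∑ i, f i) := by
  rw [Fin.sum_univ_two]
  exact (hf 0).add (hf 1)

theorem TorusSmooth.ip {A B : Torus → E3} (hA : TorusSmooth A) (hB : TorusSmooth B) :
    TorusSmooth (ip A B) := ContDiff.inner ℝ hA hB

theorem partialD_add {f g : Torus → F} (hf : TorusSmooth f) (hg : TorusSmooth g) (i : Fin 2) :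
    Biharmonic.partialD i (f + g) = Biharmonic.partialD i f + Biharmonic.partialD i g := by
  funext p
  obtain ⟨x, rfl⟩ := exists_cover p
  rw [Pi.add_apply, hf.partialD_cover, hg.partialD_cover]
  exact ((hf.hasDerivAt i x).add (hg.hasDerivAt i x)).deriv

theorem partialD_const_smul {f : Torus → F} (c : ℝ) (hf : TorusSmooth f) (i : Fin 2) :
    Biharmonic.partialD i (c • f) = c • Biharmonic.partialD i f := by
  funext p
  obtain ⟨x, rfl⟩ := exists_cover p
  rw [Pi.smul_apply, hf.partialD_cover]
  exact ((hf.hasDerivAt i x).const_smul c).deriv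

end smoothness

section sections

variable {φ : SmoothMap}

theorem ip_comm (A B : Torus → E3) : ip A B = ip B A := by
  funext p; exact real_inner_comm _ _

theorem ip_add_left (A B C : Torus → E3) : ip (A + B) C = ip A C + ip B C := by
  funext p; exact inner_add_left _ _ _

theorem ip_smul_left (c : ℝ) (A B : Torus → E3) : ip (c • A) B = c • ip A B := by
  funext p; exact real_inner_smul_left _ _ _

theorem ip_add_right (A B C : Torus → E3) : ip A (B + C) = ip A B + ip A C := by
  funext p; exact inner_add_right _ _ _

theorem ip_smul_right (c : ℝ) (A B : Torus → E3) : ip A (c • B) = c • ip A B := by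
  funext p; exact real_inner_smul_right _ _ _

theorem ip_vec_self (φ : SmoothMap) (p : Torus) : ip φ.vec φ.vec p = 1 := by
  have h : ‖φ.vec p‖ = 1 := by simp [SmoothMap.vec]
  simp [ip, h]

theorem IsSection.add {V W : Torus → E3} (hV : IsSection φ V) (hW : IsSection φ W) :
    IsSection φ (V + W) :=
  ⟨hV.1.add hW.1, fun p => by rw [ip_add_left, Pi.add_apply, hV.2, hW.2, add_zero]⟩

theorem IsSection.const_smul {V : Torus → E3} (c : ℝ) (hV : IsSection φ V) :
    IsSection φ (c • V) :=
  ⟨hV.1.const_smul c, fun p => by rw [ip_smul_left, Pi.smul_apply, hV.2, smul_zero]⟩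

theorem IsSection.neg {V : Torus → E3} (hV : IsSection φ V) : IsSection φ (-V) := by
  simpa using hV.const_smul (-1)

theorem IsSection.sub {V W : Torus → E3} (hV : IsSection φ V) (hW : IsSection φ W) :
    IsSection φ (V - W) := by
  rw [sub_eq_add_neg]; exact hV.add hW.neg

theorem IsSection.smul {c : Torus → ℝ} {V : Torus → E3} (hc : TorusSmooth c)
    (hV : IsSection φ V) : IsSection φ (c • V) :=
  ⟨hc.smul hV.1, fun p => by
    have h := hV.2 p
    simp only [ip, Pi.smul_apply', real_inner_smul_left] at h ⊢
    rw [h, mul_zero]⟩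

theorem IsSection.sum {V : Fin 2 → Torus → E3} (hV : ∀ i, IsSection φ (V i)) :
    IsSection φ (∑ i, V i) := by
  rw [Fin.sum_univ_two]
  exact (hV 0).add (hV 1)

theorem IsSection.tangential {V : Torus → E3} (hV : TorusSmooth V) :
    IsSection φ (tangential φ V) := by
  refine ⟨hV.sub ((hV.ip φ.smooth').smul φ.smooth'), fun p => ?_⟩
  have h := ip_vec_self φ p
  simp only [ip, Biharmonic.tangential, Pi.sub_apply, Pi.smul_apply', inner_sub_left,
    real_inner_smul_left] at h ⊢
  rw [h]; ring

theorem IsSection.nabla {V : Torus → E3} (hV : IsSection φ V) (i : Fin 2) :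
    IsSection φ (nabla φ i V) := IsSection.tangential (hV.1.partialD i)

theorem isSection_dmap (φ : SmoothMap) (i : Fin 2) : IsSection φ (dmap φ i) := by
  refine ⟨TorusSmooth.partialD φ.smooth' i, fun p => ?_⟩
  obtain ⟨x, rfl⟩ := exists_cover p
  have h1 := TorusSmooth.hasDerivAt (f := φ.vec) φ.smooth' i x
  have h2 := h1.inner ℝ h1
  have h3 : (fun s : ℝ => ⟪φ.vec (cover x + cover (s • dir i)),
      φ.vec (cover x + cover (s • dir i))⟫_ℝ) = fun _ => 1 := by
    funext s; exact ip_vec_self φ _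
  rw [h3] at h2
  have h4 := h2.unique (hasDerivAt_const (0 : ℝ) (1 : ℝ))
  have h5 : cover ((0 : ℝ) • dir i) = 0 := by rw [zero_smul]; rfl
  rw [h5, add_zero, real_inner_comm] at h4
  have h6 : dmap φ i (cover x) = fderiv ℝ (fun y => φ.vec (cover y)) x (dir i) :=
    TorusSmooth.partialD_cover (f := φ.vec) φ.smooth' i x
  simp only [ip, h6]
  linarith

theorem IsSection.roughLaplacian {V : Torus → E3} (hV : IsSection φ V) :
    IsSection φ (roughLaplacian φ V) := (IsSection.sum fun i => (hV.nabla i).nabla i).neg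

theorem isSection_tension (φ : SmoothMap) : IsSection φ (tension φ) :=
  IsSection.sum fun i => (isSection_dmap φ i).nabla i

theorem TorusSmooth.ipForm {A B : Fin 2 → Torus → E3} (hA : ∀ i, IsSection φ (A i))
    (hB : ∀ i, IsSection φ (B i)) : TorusSmooth (ipForm A B) :=
  TorusSmooth.sum fun i => (hA i).1.ip (hB i).1

theorem IsSection.traceForm {A B C : Fin 2 → Torus → E3} (hA : ∀ i, IsSection φ (A i))
    (hB : ∀ i, IsSection φ (B i)) (hC : ∀ i, IsSection φ (C i)) :
    IsSection φ (traceForm A B C) :=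
  IsSection.sum fun i => IsSection.smul ((hA i).1.ip (hB i).1) (hC i)

theorem IsSection.cst {V : Torus → E3} (hV : IsSection φ V) (i : Fin 2) :
    IsSection φ (cst V i) := hV

theorem IsSection.dsec {V : Torus → E3} (hV : IsSection φ V) (i : Fin 2) :
    IsSection φ (dsec φ V i) := hV.nabla i

theorem IsSection.jacobiField {V : Torus → E3} (hV : IsSection φ V) :
    IsSection φ (jacobiField φ V) := by
  have hd := isSection_dmap φ
  have ht := isSection_tension φ
  have he : TorusSmooth (Biharmonic.ipForm (dmap φ) (dmap φ)) := TorusSmooth.ipForm hd hd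
  have hL := hV.roughLaplacian
  have hT := IsSection.traceForm hV.cst hd hd
  unfold Biharmonic.jacobiField
  exact ((((((((((((hL.roughLaplacian).add ((hT.sub (hV.smul he)).roughLaplacian)).add
    ((hV.smul (TorusSmooth.ipForm ht.dsec hd)).const_smul 2)).add
    (hV.smul (ht.1.ip ht.1))).sub
    ((IsSection.traceForm hV.cst ht.dsec hd).const_smul 2)).sub
    ((IsSection.traceForm ht.cst hV.dsec hd).const_smul 2)).sub
    (ht.smul (ht.1.ip hV.1))).add
    (IsSection.traceForm hd hL.cst hd)).add
    (IsSection.traceForm hd hT.cst hd)).sub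
    (((IsSection.traceForm hd hV.cst hd).smul he).const_smul 2)).add
    ((ht.smul (TorusSmooth.ipForm hV.dsec hd)).const_smul 2)).sub
    (hL.smul he)).add (hV.smul he.sq)

theorem tangential_add (V W : Torus → E3) :
    tangential φ (V + W) = tangential φ V + tangential φ W := by
  simp only [tangential, ip_add_left, add_smul]; abel

theorem smul_field (c : ℝ) (a : Torus → ℝ) (V : Torus → E3) : (c • a) • V = c • (a • V) := by
  funext p; simp [mul_smul]

theorem smul_field_comm (c : ℝ) (a : Torus → ℝ) (V : Torus → E3) :
    a • (c • V) = c • (a • V) := by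
  funext p; simp [smul_smul, mul_comm]

theorem tangential_const_smul (c : ℝ) (V : Torus → E3) :
    tangential φ (c • V) = c • tangential φ V := by
  simp only [tangential, ip_smul_left, smul_field, smul_sub]

theorem nabla_add {V W : Torus → E3} (hV : IsSection φ V) (hW : IsSection φ W) (i : Fin 2) :
    nabla φ i (V + W) = nabla φ i V + nabla φ i W := by
  simp only [nabla, partialD_add hV.1 hW.1, tangential_add]

theorem nabla_const_smul {V : Torus → E3} (c : ℝ) (hV : IsSection φ V) (i : Fin 2) :
    nabla φ i (c • V) = c • nabla φ i V := by
  simp only [nabla, partialD_const_smul c hV.1, tangential_const_smul]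

theorem roughLaplacian_add {V W : Torus → E3} (hV : IsSection φ V) (hW : IsSection φ W) :
    roughLaplacian φ (V + W) = roughLaplacian φ V + roughLaplacian φ W := by
  simp only [roughLaplacian, Fin.sum_univ_two, nabla_add hV hW,
    nabla_add (hV.nabla _) (hW.nabla _)]
  abel

theorem roughLaplacian_const_smul {V : Torus → E3} (c : ℝ) (hV : IsSection φ V) :
    roughLaplacian φ (c • V) = c • roughLaplacian φ V := by
  simp only [roughLaplacian, Fin.sum_univ_two, nabla_const_smul c hV,
    nabla_const_smul c (hV.nabla _), smul_add, smul_neg]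

theorem jacobiField_add {V W : Torus → E3} (hV : IsSection φ V) (hW : IsSection φ W) :
    jacobiField φ (V + W) = jacobiField φ V + jacobiField φ W := by
  have hd := isSection_dmap φ
  have he : TorusSmooth (ipForm (dmap φ) (dmap φ)) := TorusSmooth.ipForm hd hd
  have key : ∀ U, IsSection φ U →
      IsSection φ (traceForm (cst U) (dmap φ) (dmap φ) - ipForm (dmap φ) (dmap φ) • U) :=
    fun U hU => (IsSection.traceForm hU.cst hd hd).sub (hU.smul he)
  have split : traceForm (cst (V + W)) (dmap φ) (dmap φ) - ipForm (dmap φ) (dmap φ) • (V + W)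
      = (traceForm (cst V) (dmap φ) (dmap φ) - ipForm (dmap φ) (dmap φ) • V)
        + (traceForm (cst W) (dmap φ) (dmap φ) - ipForm (dmap φ) (dmap φ) • W) := by
    simp only [traceForm, cst, Fin.sum_univ_two, ip_add_left, add_smul, smul_add]
    abel
  unfold jacobiField
  rw [split, roughLaplacian_add (key V hV) (key W hW), roughLaplacian_add hV hW,
    roughLaplacian_add hV.roughLaplacian hW.roughLaplacian]
  simp only [traceForm, ipForm, cst, dsec, Fin.sum_univ_two, ip_add_left, ip_add_right,
    nabla_add hV hW, add_smul, smul_add]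
  abel

theorem jacobiField_const_smul {V : Torus → E3} (c : ℝ) (hV : IsSection φ V) :
    jacobiField φ (c • V) = c • jacobiField φ V := by
  have hd := isSection_dmap φ
  have he : TorusSmooth (ipForm (dmap φ) (dmap φ)) := TorusSmooth.ipForm hd hd
  have key : IsSection φ
      (traceForm (cst V) (dmap φ) (dmap φ) - ipForm (dmap φ) (dmap φ) • V) :=
    (IsSection.traceForm hV.cst hd hd).sub (hV.smul he)
  have split : traceForm (cst (c • V)) (dmap φ) (dmap φ) - ipForm (dmap φ) (dmap φ) • (c • V)
      = c • (traceForm (cst V) (dmap φ) (dmap φ) - ipForm (dmap φ) (dmap φ) • V) := by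
    simp only [traceForm, cst, Fin.sum_univ_two, ip_smul_left, smul_field, smul_field_comm,
      smul_add, smul_sub]
  unfold jacobiField
  rw [split, roughLaplacian_const_smul c key, roughLaplacian_const_smul c hV,
    roughLaplacian_const_smul c hV.roughLaplacian]
  simp only [traceForm, ipForm, cst, dsec, Fin.sum_univ_two, ip_smul_left, ip_smul_right,
    ip_add_right, nabla_const_smul c hV, smul_field, smul_field_comm, add_smul, smul_add, smul_sub,
    smul_comm (2 : ℝ) c]

end sections

/-- The real vector space `𝒞(φ⁻¹T𝕊²)` of smooth sections of the pull-back bundle. -/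
def Sections (φ : SmoothMap) : Submodule ℝ (Torus → E3) where
  carrier := {V | IsSection φ V}
  add_mem' hV hW := IsSection.add hV hW
  zero_mem' := ⟨contDiff_const, fun p => by simp [ip]⟩
  smul_mem' c _ hV := IsSection.const_smul c hV

/-- The iterated Jacobi operator `I₂ : 𝒞(φ⁻¹T𝕊²) → 𝒞(φ⁻¹T𝕊²)`. -/
def iteratedJacobi (φ : SmoothMap) : Module.End ℝ (Sections φ) where
  toFun V := ⟨jacobiField φ V, IsSection.jacobiField V.2⟩
  map_add' V W := Subtype.ext (jacobiField_add V.2 W.2)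
  map_smul' c V := Subtype.ext (jacobiField_const_smul c V.2)

/-- `Nullity(φ) = dim {V ∈ 𝒞(φ⁻¹T𝕊²) : I₂(V) = 0}`, as a cardinal. -/
def nullity (φ : SmoothMap) : Cardinal := Module.rank ℝ (LinearMap.ker (iteratedJacobi φ))

/-- `Index(φ)`, the sum of the dimensions of the eigenspaces of `I₂` over all negative eigenvalues,
as a cardinal (a negative number that is not an eigenvalue contributes `0`). -/
def index (φ : SmoothMap) : Cardinal :=
  Cardinal.sum fun μ : {μ : ℝ // μ < 0} =>
    Module.rank ℝ (Module.End.eigenspace (iteratedJacobi φ) (μ : ℝ))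

/-- The map `φ_k(γ, ϑ) = (sin α* cos kγ, sin α* sin kγ, cos α*)` with `α* = π/4`. -/
def phi (k : ℕ) : SmoothMap where
  toFun p := ⟨!₂[Real.sin (Real.pi / 4) * Real.Angle.cos (k • p.1),
      Real.sin (Real.pi / 4) * Real.Angle.sin (k • p.1), Real.cos (Real.pi / 4)], by
    have h1 := Real.Angle.cos_sq_add_sin_sq (k • p.1)
    have h2 := Real.sin_sq_add_cos_sq (Real.pi / 4)
    rw [mem_sphere_zero_iff_norm, EuclideanSpace.norm_eq, Real.sqrt_eq_one, Fin.sum_univ_three]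
    simp only [Real.norm_eq_abs, sq_abs, Matrix.cons_val]
    linear_combination (Real.sin (Real.pi / 4)) ^ 2 * h1 + h2⟩
  smooth' := by
    have h : ∀ x : ℝ × ℝ, (k • (cover x).1 : Real.Angle) = ((k * x.1 : ℝ) : Real.Angle) := by
      intro x
      rw [← nsmul_eq_mul, Real.Angle.coe_nsmul]; rfl
    unfold TorusSmooth
    simp only [h, Real.Angle.cos_coe, Real.Angle.sin_coe]
    rw [contDiff_euclidean]
    intro i
    fin_cases i <;> simp <;> fun_prop

/-- The number `λ⁻_{m,n}`, for given `k`. -/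
def lambdaMinus (k m n : ℕ) : ℝ :=
  (1 / 2) * (-(k : ℝ) ^ 4 + (k : ℝ) ^ 2 * (5 * (m : ℝ) ^ 2 + (n : ℝ) ^ 2)
    + 2 * ((m : ℝ) ^ 2 + (n : ℝ) ^ 2) ^ 2
    - √((k : ℝ) ^ 8 + 2 * (k : ℝ) ^ 6 * ((m : ℝ) ^ 2 + (n : ℝ) ^ 2)
        + (k : ℝ) ^ 4 * ((m : ℝ) ^ 2 + (n : ℝ) ^ 2) ^ 2
        + 32 * (k : ℝ) ^ 2 * (m : ℝ) ^ 2 * ((m : ℝ) ^ 2 + (n : ℝ) ^ 2) ^ 2))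

/-- `f(k)`, the number of pairs `m, n ≥ 1` with `λ⁻_{m,n} < 0` (a finite set for `k ≥ 1`). -/
def countNeg (k : ℕ) : ℕ :=
  Set.ncard {q : ℕ × ℕ | 1 ≤ q.1 ∧ 1 ≤ q.2 ∧ lambdaMinus k q.1 q.2 < 0}

/-- `g(k)`, the number of pairs `m, n ≥ 1` with `λ⁻_{m,n} = 0` (a finite set for `k ≥ 1`). -/
def countZero (k : ℕ) : ℕ :=
  Set.ncard {q : ℕ × ℕ | 1 ≤ q.1 ∧ 1 ≤ q.2 ∧ lambdaMinus k q.1 q.2 = 0}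

end Biharmonic

end

/-! Along `phi k` the pull-back bundle has a global orthonormal frame: `frameOne`, tangent to the
parallel traced by the map, and `frameTwo`, orthogonal to it. The first component of the connection
rotates this frame at the constant rate `slope k`, the second leaves it parallel, and `dmap`,
`tension` and the derivative of `tension` are constant multiples of frame vectors. In this frame
$I_2$ is therefore a 2×2 system of differential operators with constant coefficients on the torus,
and Fourier analysis diagonalises it.

The real system `cas m = cos + sin`, indexed by all integers, satisfies `cas m' = m * cas (-m)`. The
couplings between the two components are of odd order in $\partial_\gamma$, so the mode $(m,n)$ of
the first component meets only the mode $(-m,n)$ of the second. On this pair $I_2$ acts by the real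
symmetric matrix with entries `symbolOne`, `symbolMixed`, `symbolTwo` (`coeffOne_jacobiField`,
`coeffTwo_jacobiField`), whose eigenvalues are `lambdaPlus` and `lambdaMinus`. Its eigenvectors give
functionals that are eigenvectors of the transpose of $I_2$, together with biorthogonal
eigensections. Smooth sections are determined by their coefficients, so
`rank_eigenspace_of_biorthogonal` turns dimensions into counts of modes in $\mathbb Z^2$, with no
elliptic theory.

It remains to find the nonpositive eigenvalues. `lambdaPlus` is positive except at the origin, where
it is 0. `lambdaMinus` equals $n^4-k^4$ at $(0,n)$, has the sign of $m^2-k^2$ at $(m,0)$ for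
$m\ge1$, and is positive outside a box. Signs of $(m,n)$ give orbits of size 1, 2 or 4, which
produces the constants in the statement. -/

noncomputable section

namespace Biharmonic

open intervalIntegral MeasureTheory

/-! ### Fourier analysis on the circle with the system `cas` -/

/-- The real trigonometric system `cos (m x) + sin (m x)`, indexed by `m ∈ ℤ`. -/
def cas (m : ℤ) (x : ℝ) : ℝ := Real.cos (m * x) + Real.sin (m * x)

theorem contDiff_cas (m : ℤ) : ContDiff ℝ ∞ (cas m) := by
  unfold cas; fun_prop

theorem continuous_cas (m : ℤ) : Continuous (cas m) := (contDiff_cas m).continuous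

/-- Differentiation reflects the frequency; this reflection is why the mode $m$ of one component
will be paired with $-m$ of the other. -/
theorem hasDerivAt_cas (m : ℤ) (x : ℝ) : HasDerivAt (cas m) (m * cas (-m) x) x := by
  have h : HasDerivAt (fun x : ℝ => (m : ℝ) * x) m x := by
    simpa using (hasDerivAt_id x).const_mul (m : ℝ)
  refine (h.cos.add h.sin).congr_deriv ?_
  simp only [cas, Int.cast_neg, neg_mul, Real.cos_neg, Real.sin_neg]
  ring

theorem cas_two_pi (m : ℤ) : cas m (2 * Real.pi) = cas m 0 := by
  have h : Real.sin (m * (2 * Real.pi)) = 0 := Real.sin_eq_zero_iff.2 ⟨2 * m, by push_cast; ring⟩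
  simp [cas, Real.cos_int_mul_two_pi, h]

theorem integral_add_of_continuous {f g : ℝ → ℝ} (hf : Continuous f) (hg : Continuous g)
    (a b : ℝ) : ∫ x in a..b, (f x + g x) = (∫ x in a..b, f x) + ∫ x in a..b, g x :=
  intervalIntegral.integral_add (hf.intervalIntegrable _ _) (hg.intervalIntegrable _ _)

/-- Integration by parts over a period against `cas m`. -/
theorem integral_deriv_mul_cas (m : ℤ) {f f' : ℝ → ℝ} (hf : ∀ x, HasDerivAt f (f' x) x)
    (hf' : Continuous f') (hper : f (2 * Real.pi) = f 0) :
    ∫ x in (0 : ℝ)..2 * Real.pi, f' x * cas m x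
      = -m * ∫ x in (0 : ℝ)..2 * Real.pi, f x * cas (-m) x := by
  have hfc : Continuous f := continuous_iff_continuousAt.2 fun x => (hf x).continuousAt
  have hc : Continuous fun x => (m : ℝ) * cas (-m) x := (continuous_cas (-m)).const_mul _
  have key := integral_deriv_mul_eq_sub (a := 0) (b := 2 * Real.pi) (fun x _ => hf x)
    (fun x _ => hasDerivAt_cas m x) (hf'.intervalIntegrable _ _) (hc.intervalIntegrable _ _)
  rw [cas_two_pi, hper, sub_self, integral_add_of_continuous (hf'.fun_mul (continuous_cas m))
    (hfc.fun_mul hc)] at key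
  rw [eq_neg_of_add_eq_zero_left key, neg_mul, ← intervalIntegral.integral_const_mul]
  congr 2; funext x; ring

theorem integral_cos_int_mul (m : ℤ) (hm : m ≠ 0) :
    ∫ x in (0 : ℝ)..2 * Real.pi, Real.cos (m * x) = 0 := by
  have hm' : (m : ℝ) ≠ 0 := by exact_mod_cast hm
  rw [intervalIntegral.integral_comp_mul_left (fun x => Real.cos x) hm', integral_cos,
    Real.sin_eq_zero_iff.2 ⟨2 * m, by push_cast; ring⟩]
  simp

theorem integral_sin_int_mul (m : ℤ) :
    ∫ x in (0 : ℝ)..2 * Real.pi, Real.sin (m * x) = 0 := by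
  rcases eq_or_ne m 0 with rfl | hm
  · simp
  have hm' : (m : ℝ) ≠ 0 := by exact_mod_cast hm
  rw [intervalIntegral.integral_comp_mul_left (fun x => Real.sin x) hm', integral_sin,
    Real.cos_int_mul_two_pi]
  simp

/-- The sine term always integrates to zero over a period and the cosine term does so unless `m =
n`. Hence every `cas m`, including the constant one, has the same squared norm $2\pi$. -/
theorem cas_mul_cas (m n : ℤ) (x : ℝ) :
    cas m x * cas n x = Real.cos ((m - n : ℤ) * x) + Real.sin ((m + n : ℤ) * x) := by
  simp only [cas]
  push_cast
  rw [sub_mul, add_mul (m : ℝ) n x, Real.cos_sub, Real.sin_add]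
  ring

theorem integral_cas_mul_cas (m n : ℤ) :
    ∫ x in (0 : ℝ)..2 * Real.pi, cas m x * cas n x = if m = n then 2 * Real.pi else 0 := by
  simp_rw [cas_mul_cas]
  rw [integral_add_of_continuous (by fun_prop) (by fun_prop), integral_sin_int_mul, add_zero]
  split_ifs with h
  · simp [h]
  · exact integral_cos_int_mul _ (sub_ne_zero.2 h)

/-- A continuous function on the circle whose coefficients against all `cas m` vanish is zero. -/
theorem eq_zero_of_integral_mul_cas_eq_zero {f : AddCircle (2 * Real.pi) → ℝ}
    (hf : Continuous f)
    (h : ∀ m : ℤ, ∫ x in (0 : ℝ)..2 * Real.pi, f x * cas m x = 0) : f = 0 := by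
  have : Fact (0 < 2 * Real.pi) := ⟨Real.two_pi_pos⟩
  have hfc : Continuous fun x : ℝ => f (x : AddCircle (2 * Real.pi)) :=
    hf.comp (AddCircle.continuous_mk' _)
  have hcos : ∀ m : ℤ, ∫ x in (0 : ℝ)..2 * Real.pi, f x * Real.cos (m * x) = 0 := by
    intro m
    -- The even part of `cas m` is the cosine; once the cosine integrals vanish, the sine integrals
    -- follow.
    have h1 : ∫ x in (0 : ℝ)..2 * Real.pi, (f x * cas m x + f x * cas (-m) x) = 0 := by
      rw [integral_add_of_continuous (hfc.fun_mul (continuous_cas m))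
        (hfc.fun_mul (continuous_cas (-m))),
        h, h, add_zero]
    have h2 : ∀ x : ℝ, f x * cas m x + f x * cas (-m) x = 2 * (f x * Real.cos (m * x)) := by
      intro x
      simp only [cas, Int.cast_neg, neg_mul, Real.cos_neg, Real.sin_neg]; ring
    simp_rw [h2] at h1
    rw [intervalIntegral.integral_const_mul] at h1
    linarith
  have hsin : ∀ m : ℤ, ∫ x in (0 : ℝ)..2 * Real.pi, f x * Real.sin (m * x) = 0 := by
    intro m
    have h1 := h m
    simp only [cas, mul_add] at h1
    rwa [integral_add_of_continuous (hfc.fun_mul (by fun_prop)) (hfc.fun_mul (by fun_prop)), hcos,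
      zero_add] at h1
  let F : C(AddCircle (2 * Real.pi), ℂ) := ⟨fun x => (f x : ℂ), Complex.continuous_ofReal.comp hf⟩
  have hF : fourierCoeff F = 0 := by
    funext n
    rw [fourierCoeff_eq_intervalIntegral _ n 0, zero_add]
    have h3 : ∀ x : ℝ, (fourier (-n) (x : AddCircle (2 * Real.pi)) : ℂ) • F x
        = ((f x * Real.cos (n * x) : ℝ) : ℂ) - ((f x * Real.sin (n * x) : ℝ) : ℂ) * Complex.I := by
      intro x
      have h4 : 2 * Real.pi * Complex.I * ((-n : ℤ) : ℂ) * x / (2 * Real.pi : ℝ)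
          = (-(n * x : ℝ) : ℂ) * Complex.I := by
        have := Real.pi_ne_zero
        push_cast
        field_simp
      rw [fourier_coe_apply, h4, Complex.exp_mul_I, Complex.cos_neg, Complex.sin_neg]
      simp only [F, ContinuousMap.coe_mk, smul_eq_mul]
      push_cast
      ring
    simp_rw [h3]
    rw [integral_sub (Continuous.intervalIntegrable (by fun_prop) _ _)
      (Continuous.intervalIntegrable (by fun_prop) _ _), intervalIntegral.integral_mul_const,
      intervalIntegral.integral_ofReal, intervalIntegral.integral_ofReal, hcos, hsin]
    simp
  funext x
  -- All complex coefficients vanish, so the Fourier series is trivially summable and converges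
  -- pointwise to `F`; hence `F` is 0.
  have h5 := has_pointwise_sum_fourier_series_of_summable (f := F)
    (by rw [hF]; exact summable_zero) x
  simp only [hF, Pi.zero_apply, zero_smul] at h5
  exact Complex.ofReal_eq_zero.1 (h5.unique hasSum_zero)

/-- The same for periodic functions on the line that come from the circle. -/
theorem angle_eq_zero_of_integral_mul_cas_eq_zero {f : Real.Angle → ℝ}
    (hf : Continuous fun x : ℝ => f x)
    (h : ∀ m : ℤ, ∫ x in (0 : ℝ)..2 * Real.pi, f x * cas m x = 0) (x : Real.Angle) :
    f x = 0 := by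
  -- `Real.Angle` is by definition `AddCircle (2 * Real.pi)`, a quotient of the line, so continuity
  -- descends from the lift.
  have hf' : Continuous (f : AddCircle (2 * Real.pi) → ℝ) :=
    continuous_quot_lift (f := fun x : ℝ => f x) (by
      intro a b hab
      exact congrArg f (Quotient.sound hab)) hf |>.congr (by
      intro a
      induction a using Quotient.inductionOn
      rfl)
  exact congrFun (eq_zero_of_integral_mul_cas_eq_zero hf' h) x

/-! ### Trigonometric coefficients on the torus -/

/-- The coefficient of a function on the torus with respect to `cas m γ * cas n ϑ`. -/
def torusCoeff (m n : ℤ) (u : Torus → ℝ) : ℝ :=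
  ∫ x in (0 : ℝ)..2 * Real.pi, ∫ y in (0 : ℝ)..2 * Real.pi, u (cover (x, y)) * (cas m x * cas n y)

theorem TorusSmooth.continuous_cover {u : Torus → ℝ} (hu : TorusSmooth u) :
    Continuous fun z : ℝ × ℝ => u (cover z) := ContDiff.continuous hu

theorem TorusSmooth.continuous_mul_cas {u : Torus → ℝ} (hu : TorusSmooth u) (m n : ℤ) :
    Continuous fun z : ℝ × ℝ => u (cover z) * (cas m z.1 * cas n z.2) :=
  hu.continuous_cover.mul (((continuous_cas m).comp continuous_fst).mul
    ((continuous_cas n).comp continuous_snd))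

theorem torusCoeff_add (m n : ℤ) {u v : Torus → ℝ} (hu : TorusSmooth u) (hv : TorusSmooth v) :
    torusCoeff m n (u + v) = torusCoeff m n u + torusCoeff m n v := by
  have hu' := hu.continuous_mul_cas m n
  have hv' := hv.continuous_mul_cas m n
  unfold torusCoeff
  rw [← integral_add_of_continuous]
  · congr 1; funext x
    rw [← integral_add_of_continuous]
    · simp [add_mul]
    · exact hu'.comp (Continuous.prodMk_right x)
    · exact hv'.comp (Continuous.prodMk_right x)
  · exact continuous_parametric_intervalIntegral_of_continuous' hu' _ _
  · exact continuous_parametric_intervalIntegral_of_continuous' hv' _ _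

theorem torusCoeff_smul (m n : ℤ) (c : ℝ) (u : Torus → ℝ) :
    torusCoeff m n (c • u) = c * torusCoeff m n u := by
  unfold torusCoeff
  simp only [Pi.smul_apply, smul_eq_mul, mul_assoc, intervalIntegral.integral_const_mul]

theorem integral_integral_swap_of_continuous {F : ℝ → ℝ → ℝ} (hF : Continuous F.uncurry)
    (a b c d : ℝ) :
    ∫ x in a..b, ∫ y in c..d, F x y = ∫ y in c..d, ∫ x in a..b, F x y := by
  refine intervalIntegral_intervalIntegral_swap ?_
  exact (hF.continuousOn.integrableOn_compact (isCompact_uIcc.prod isCompact_uIcc)).mono_set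
    (Set.prod_mono Set.uIoc_subset_uIcc Set.uIoc_subset_uIcc)

/-- Puts the $\gamma$-integral inside, where integration by parts in $\gamma$ can be applied. -/
theorem torusCoeff_swap (m n : ℤ) {u : Torus → ℝ} (hu : TorusSmooth u) :
    torusCoeff m n u = ∫ y in (0 : ℝ)..2 * Real.pi, cas n y *
      ∫ x in (0 : ℝ)..2 * Real.pi, u (cover (x, y)) * cas m x := by
  unfold torusCoeff
  rw [integral_integral_swap_of_continuous
    (F := fun x y => u (cover (x, y)) * (cas m x * cas n y)) (hu.continuous_mul_cas m n)]
  simp_rw [← intervalIntegral.integral_const_mul]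
  congr 1; funext y; congr 1; funext x; ring

theorem torusCoeff_eq (m n : ℤ) (u : Torus → ℝ) :
    torusCoeff m n u = ∫ x in (0 : ℝ)..2 * Real.pi, cas m x *
      ∫ y in (0 : ℝ)..2 * Real.pi, u (cover (x, y)) * cas n y := by
  unfold torusCoeff
  simp_rw [← intervalIntegral.integral_const_mul]
  congr 1; funext y; congr 1; funext x; ring

theorem torusCoeff_partialD_zero (m n : ℤ) {u : Torus → ℝ} (hu : TorusSmooth u) :
    torusCoeff m n (partialD 0 u) = -m * torusCoeff (-m) n u := by
  have key : ∀ y : ℝ, ∫ x in (0 : ℝ)..2 * Real.pi, partialD 0 u (cover (x, y)) * cas m x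
      = -m * ∫ x in (0 : ℝ)..2 * Real.pi, u (cover (x, y)) * cas (-m) x := by
    intro y
    refine integral_deriv_mul_cas m (fun x => ?_)
      ((hu.partialD 0).continuous_cover.comp (Continuous.prodMk_left y)) (by simp [cover])
    rw [hu.partialD_cover 0]
    exact ((ContDiff.differentiable hu (by simp)) (x, y)).hasFDerivAt.comp_hasDerivAt x
      ((hasDerivAt_id x).prodMk (hasDerivAt_const x y))
  rw [torusCoeff_swap _ _ (hu.partialD 0), torusCoeff_swap _ _ hu]
  simp_rw [key, ← intervalIntegral.integral_const_mul]
  congr 1; funext y; congr 1; funext x; ring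

theorem torusCoeff_partialD_one (m n : ℤ) {u : Torus → ℝ} (hu : TorusSmooth u) :
    torusCoeff m n (partialD 1 u) = -n * torusCoeff m (-n) u := by
  have key : ∀ x : ℝ, ∫ y in (0 : ℝ)..2 * Real.pi, partialD 1 u (cover (x, y)) * cas n y
      = -n * ∫ y in (0 : ℝ)..2 * Real.pi, u (cover (x, y)) * cas (-n) y := by
    intro x
    refine integral_deriv_mul_cas n (fun y => ?_)
      ((hu.partialD 1).continuous_cover.comp (Continuous.prodMk_right x)) (by simp [cover])
    rw [hu.partialD_cover 1]
    exact ((ContDiff.differentiable hu (by simp)) (x, y)).hasFDerivAt.comp_hasDerivAt y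
      ((hasDerivAt_const y x).prodMk (hasDerivAt_id y))
  simp_rw [torusCoeff_eq, key, ← intervalIntegral.integral_const_mul]
  congr 1; funext y; congr 1; funext x; ring

/-- A smooth function on the torus is determined by its trigonometric coefficients. -/
theorem eq_zero_of_torusCoeff_eq_zero {u : Torus → ℝ} (hu : TorusSmooth u)
    (h : ∀ m n, torusCoeff m n u = 0) : u = 0 := by
  -- One variable at a time: for fixed `n` the partial coefficient in $\vartheta$ is a continuous
  -- function of $\gamma$ with vanishing coefficients, hence zero; then the circle result applies in
  -- $\vartheta$ for each fixed `a`.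
  have h1 : ∀ (n : ℤ) (a : Real.Angle),
      ∫ y in (0 : ℝ)..2 * Real.pi, u (a, (y : Real.Angle)) * cas n y = 0 := by
    intro n
    refine angle_eq_zero_of_integral_mul_cas_eq_zero ?_ ?_
    · refine continuous_parametric_intervalIntegral_of_continuous'
        (f := fun (x y : ℝ) => u ((x : Real.Angle), (y : Real.Angle)) * cas n y) ?_ _ _
      exact hu.continuous_cover.mul ((continuous_cas n).comp continuous_snd)
    · intro m
      refine Eq.trans ?_ ((torusCoeff_eq m n u).symm.trans (h m n))
      congr 1; funext x
      rw [mul_comm]; rfl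
  funext ⟨a, b⟩
  refine angle_eq_zero_of_integral_mul_cas_eq_zero (f := fun b => u (a, b)) ?_ (fun n => h1 n a) b
  induction a using Real.Angle.induction_on with
  | _ x => exact hu.continuous_cover.comp (Continuous.prodMk_right x)

/-- The function `cas m γ * cas n ϑ` on the torus. -/
def casFun (m n : ℤ) (p : Torus) : ℝ :=
  (Real.Angle.cos (m • p.1) + Real.Angle.sin (m • p.1))
    * (Real.Angle.cos (n • p.2) + Real.Angle.sin (n • p.2))

theorem casFun_cover (m n : ℤ) (z : ℝ × ℝ) : casFun m n (cover z) = cas m z.1 * cas n z.2 := by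
  simp only [casFun, cover, cas, ← Real.Angle.coe_zsmul, Real.Angle.cos_coe, Real.Angle.sin_coe,
    zsmul_eq_mul]

theorem torusSmooth_casFun (m n : ℤ) : TorusSmooth (casFun m n) := by
  unfold TorusSmooth
  simp_rw [casFun_cover]
  exact ((contDiff_cas m).comp contDiff_fst).mul ((contDiff_cas n).comp contDiff_snd)

theorem torusCoeff_casFun (m n m' n' : ℤ) :
    torusCoeff m n (casFun m' n') = if m' = m ∧ n' = n then (2 * Real.pi) ^ 2 else 0 := by
  have h : ∀ x y : ℝ, casFun m' n' (cover (x, y)) * (cas m x * cas n y)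
      = (cas m' x * cas m x) * (cas n' y * cas n y) := by
    intro x y; rw [casFun_cover]; ring
  unfold torusCoeff
  simp_rw [h, intervalIntegral.integral_const_mul, intervalIntegral.integral_mul_const,
    integral_cas_mul_cas]
  by_cases h1 : m' = m <;> by_cases h2 : n' = n <;> simp [h1, h2, sq]

/-! ### The orthonormal frame along `phi k` -/

/-- The norm of `dφ_k(∂/∂γ)`. -/
def slope (k : ℕ) : ℝ := k * (√2 / 2)

theorem slope_sq (k : ℕ) : slope k ^ 2 = (k : ℝ) ^ 2 / 2 := by
  rw [slope, mul_pow, div_pow, Real.sq_sqrt (by norm_num)]; ring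

/-- The unit tangent field along `φ_k` in the direction of `∂φ_k/∂γ`. -/
def frameOne (k : ℕ) (p : Torus) : E3 :=
  !₂[-Real.Angle.sin (k • p.1), Real.Angle.cos (k • p.1), 0]

/-- The unit tangent field along `φ_k` orthogonal to the parallels. -/
def frameTwo (k : ℕ) (p : Torus) : E3 :=
  !₂[√2 / 2 * Real.Angle.cos (k • p.1), √2 / 2 * Real.Angle.sin (k • p.1), -(√2 / 2)]

theorem nsmul_coe_angle (k : ℕ) (x : ℝ) : (k • (x : Real.Angle)) = ((k * x : ℝ) : Real.Angle) := by
  rw [← nsmul_eq_mul, Real.Angle.coe_nsmul]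

theorem phi_vec_apply (k : ℕ) (p : Torus) : (phi k).vec p =
    !₂[√2 / 2 * Real.Angle.cos (k • p.1), √2 / 2 * Real.Angle.sin (k • p.1), √2 / 2] := by
  simp [phi, SmoothMap.vec, Real.sin_pi_div_four, Real.cos_pi_div_four]

theorem torusSmooth_frameOne (k : ℕ) : TorusSmooth (frameOne k) := by
  unfold TorusSmooth frameOne
  simp only [cover, nsmul_coe_angle, Real.Angle.cos_coe, Real.Angle.sin_coe]
  rw [contDiff_euclidean]
  intro i
  fin_cases i <;> simp <;> fun_prop

theorem torusSmooth_frameTwo (k : ℕ) : TorusSmooth (frameTwo k) := by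
  unfold TorusSmooth frameTwo
  simp only [cover, nsmul_coe_angle, Real.Angle.cos_coe, Real.Angle.sin_coe]
  rw [contDiff_euclidean]
  intro i
  fin_cases i <;> simp <;> fun_prop

theorem ip_frameOne_frameOne (k : ℕ) : ip (frameOne k) (frameOne k) = 1 := by
  funext p
  have := Real.Angle.cos_sq_add_sin_sq (k • p.1)
  simp only [ip, frameOne, PiLp.inner_apply, Fin.sum_univ_three]
  simp
  linarith

theorem ip_frameTwo_frameTwo (k : ℕ) : ip (frameTwo k) (frameTwo k) = 1 := by
  funext p
  have h := Real.Angle.cos_sq_add_sin_sq (k • p.1)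
  simp only [ip, frameTwo, PiLp.inner_apply, Fin.sum_univ_three]
  simp [sq_abs, mul_pow, div_pow]
  linear_combination h / 2

theorem ip_frameOne_frameTwo (k : ℕ) : ip (frameOne k) (frameTwo k) = 0 := by
  funext p
  simp only [ip, frameOne, frameTwo, PiLp.inner_apply, Fin.sum_univ_three]
  simp
  ring

theorem ip_frameTwo_frameOne (k : ℕ) : ip (frameTwo k) (frameOne k) = 0 := by
  rw [ip_comm, ip_frameOne_frameTwo]

theorem ip_vec_frameOne (k : ℕ) : ip (phi k).vec (frameOne k) = 0 := by
  funext p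
  simp only [ip, frameOne, phi_vec_apply, PiLp.inner_apply, Fin.sum_univ_three]
  simp
  ring

theorem ip_vec_frameTwo (k : ℕ) : ip (phi k).vec (frameTwo k) = 0 := by
  funext p
  have h := Real.Angle.cos_sq_add_sin_sq (k • p.1)
  have h2 : √2 ^ 2 = 2 := Real.sq_sqrt (by norm_num)
  simp only [ip, frameTwo, phi_vec_apply, PiLp.inner_apply, Fin.sum_univ_three]
  simp [sq_abs, mul_pow, div_pow]
  linear_combination h / 2 - h2 / 4

theorem isSection_frameOne (k : ℕ) : IsSection (phi k) (frameOne k) :=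
  ⟨torusSmooth_frameOne k, fun p => by rw [ip_comm, ip_vec_frameOne]; rfl⟩

theorem isSection_frameTwo (k : ℕ) : IsSection (phi k) (frameTwo k) :=
  ⟨torusSmooth_frameTwo k, fun p => by rw [ip_comm, ip_vec_frameTwo]; rfl⟩

theorem IsSection.ip_vec {φ : SmoothMap} {V : Torus → E3} (hV : IsSection φ V) :
    ip V φ.vec = 0 := funext hV.2

/-- At each point the map and the two frame vectors form an orthonormal basis of $\mathbb R^3$, and
a section has no component along the map. -/
theorem IsSection.eq_frame {k : ℕ} {V : Torus → E3} (hV : IsSection (phi k) V) :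
    V = ip V (frameOne k) • frameOne k + ip V (frameTwo k) • frameTwo k := by
  funext p
  have h := Real.Angle.cos_sq_add_sin_sq (k • p.1)
  have h2 : √2 ^ 2 = 2 := Real.sq_sqrt (by norm_num)
  have h0 := hV.2 p
  simp only [ip, phi_vec_apply, PiLp.inner_apply, Fin.sum_univ_three] at h0
  simp at h0
  -- Orthogonality to the map, multiplied by `√2` to clear the common factor `√2 / 2`.
  have h3 : V p 0 * Real.Angle.cos (k • p.1) + V p 1 * Real.Angle.sin (k • p.1) + V p 2 = 0 := by
    linear_combination √2 * h0 - (V p 0 * Real.Angle.cos (k • p.1)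
      + V p 1 * Real.Angle.sin (k • p.1) + V p 2) / 2 * h2
  clear h0
  ext i
  simp only [Pi.add_apply, Pi.smul_apply', ip, frameOne, frameTwo, PiLp.inner_apply,
    Fin.sum_univ_three]
  generalize Real.Angle.cos (k • p.1) = c at *
  generalize Real.Angle.sin (k • p.1) = s at *
  fin_cases i
  · simp
    linear_combination -(V p 0) * h + c / 2 * h3
      - c * (V p 0 * c + V p 1 * s - V p 2) / 4 * h2
  · simp
    linear_combination -(V p 1) * h + s / 2 * h3
      - s * (V p 0 * c + V p 1 * s - V p 2) / 4 * h2
  · simp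
    linear_combination h3 / 2 + (V p 0 * c + V p 1 * s - V p 2) / 4 * h2

/-- The map and its frame depend on $\gamma$ alone, so their derivatives reduce to those of a curve
in one real variable. -/
theorem partialD_zero_of_lift {F : Type*} [NormedAddCommGroup F] [NormedSpace ℝ F]
    {f : Torus → F} {g : ℝ → F} (hfg : ∀ x, f (cover x) = g x.1) {g' : F} (x : ℝ × ℝ)
    (hg : HasDerivAt g g' x.1) : partialD 0 f (cover x) = g' := by
  unfold partialD
  simp only [← cover_add, hfg, dir]
  have h : HasDerivAt (fun s : ℝ => x.1 + s) 1 0 := by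
    simpa using (hasDerivAt_id (0 : ℝ)).const_add x.1
  have h1 : HasDerivAt g g' (x.1 + 0) := by simpa using hg
  simpa [Function.comp_def] using (h1.scomp (0 : ℝ) h).deriv

theorem partialD_one_of_lift {F : Type*} [NormedAddCommGroup F] [NormedSpace ℝ F]
    {f : Torus → F} {g : ℝ → F} (hfg : ∀ x, f (cover x) = g x.1) : partialD 1 f = 0 := by
  funext p
  obtain ⟨x, rfl⟩ := exists_cover p
  unfold partialD
  simp only [← cover_add, hfg, dir]
  simp

theorem partialD_ip {A B : Torus → E3} (hA : TorusSmooth A) (hB : TorusSmooth B) (i : Fin 2) :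
    partialD i (ip A B) = ip (partialD i A) B + ip A (partialD i B) := by
  funext p
  obtain ⟨x, rfl⟩ := exists_cover p
  have h := ((hA.hasDerivAt i x).inner ℝ (hB.hasDerivAt i x)).deriv
  have h0 : cover ((0 : ℝ) • dir i) = 0 := by rw [zero_smul]; rfl
  simp only [h0, add_zero] at h
  rw [Pi.add_apply]
  unfold ip
  rw [hA.partialD_cover, hB.partialD_cover, add_comm]
  exact h

theorem hasDerivAt_vec3 {f g h : ℝ → ℝ} {f' g' h' x : ℝ} (hf : HasDerivAt f f' x)
    (hg : HasDerivAt g g' x) (hh : HasDerivAt h h' x) :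
    HasDerivAt (fun x => (!₂[f x, g x, h x] : E3)) !₂[f', g', h'] x := by
  have hpi : HasDerivAt (fun x => ![f x, g x, h x]) ![f', g', h'] x := by
    refine hasDerivAt_pi.2 fun i => ?_
    fin_cases i
    exacts [hf, hg, hh]
  exact (EuclideanSpace.equiv (Fin 3) ℝ).symm.hasFDerivAt.comp_hasDerivAt x hpi

theorem hasDerivAt_cos_nat_mul (k : ℕ) (x : ℝ) :
    HasDerivAt (fun x : ℝ => Real.cos (k * x)) (-(k * Real.sin (k * x))) x := by
  have h : HasDerivAt (fun x : ℝ => (k : ℝ) * x) k x := by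
    simpa using (hasDerivAt_id x).const_mul (k : ℝ)
  exact h.cos.congr_deriv (by ring)

theorem hasDerivAt_sin_nat_mul (k : ℕ) (x : ℝ) :
    HasDerivAt (fun x : ℝ => Real.sin (k * x)) (k * Real.cos (k * x)) x := by
  have h : HasDerivAt (fun x : ℝ => (k : ℝ) * x) k x := by
    simpa using (hasDerivAt_id x).const_mul (k : ℝ)
  exact h.sin.congr_deriv (by ring)

theorem vec_cover (k : ℕ) (x : ℝ × ℝ) : (phi k).vec (cover x) =
    !₂[√2 / 2 * Real.cos (k * x.1), √2 / 2 * Real.sin (k * x.1), √2 / 2] := by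
  simp only [phi_vec_apply, cover, nsmul_coe_angle, Real.Angle.cos_coe, Real.Angle.sin_coe]

theorem frameOne_cover (k : ℕ) (x : ℝ × ℝ) : frameOne k (cover x) =
    !₂[-Real.sin (k * x.1), Real.cos (k * x.1), 0] := by
  simp only [frameOne, cover, nsmul_coe_angle, Real.Angle.cos_coe, Real.Angle.sin_coe]

theorem frameTwo_cover (k : ℕ) (x : ℝ × ℝ) : frameTwo k (cover x) =
    !₂[√2 / 2 * Real.cos (k * x.1), √2 / 2 * Real.sin (k * x.1), -(√2 / 2)] := by
  simp only [frameTwo, cover, nsmul_coe_angle, Real.Angle.cos_coe, Real.Angle.sin_coe]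

theorem dmap_zero (k : ℕ) : dmap (phi k) 0 = slope k • frameOne k := by
  funext p
  obtain ⟨x, rfl⟩ := exists_cover p
  rw [dmap, partialD_zero_of_lift (g := fun t => !₂[√2 / 2 * Real.cos (k * t),
    √2 / 2 * Real.sin (k * t), √2 / 2]) (vec_cover k) x
    (hasDerivAt_vec3 ((hasDerivAt_cos_nat_mul k _).const_mul _)
      ((hasDerivAt_sin_nat_mul k _).const_mul _) (hasDerivAt_const _ _)), Pi.smul_apply,
    frameOne_cover]
  ext i
  fin_cases i <;> simp [slope] <;> ring

theorem dmap_one (k : ℕ) : dmap (phi k) 1 = 0 :=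
  partialD_one_of_lift (g := fun t => !₂[√2 / 2 * Real.cos (k * t),
    √2 / 2 * Real.sin (k * t), √2 / 2]) (vec_cover k)

/-- The derivative is $-k(\cos k\gamma,\sin k\gamma,0)$. The horizontal vector is
$(\varphi+E_2)/\sqrt2$, where $E_2$ is `frameTwo`; the part along $\varphi$ is normal to the sphere
and disappears in `nabla`. -/
theorem partialD_zero_frameOne (k : ℕ) :
    partialD 0 (frameOne k) = -slope k • ((phi k).vec + frameTwo k) := by
  funext p
  obtain ⟨x, rfl⟩ := exists_cover p
  have h2 : √2 ^ 2 = 2 := Real.sq_sqrt (by norm_num)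
  rw [partialD_zero_of_lift (g := fun t => !₂[-Real.sin (k * t), Real.cos (k * t), 0])
    (frameOne_cover k) x (hasDerivAt_vec3 (hasDerivAt_sin_nat_mul k _).neg
      (hasDerivAt_cos_nat_mul k _) (hasDerivAt_const _ _)), Pi.smul_apply, Pi.add_apply,
    frameTwo_cover, vec_cover]
  ext i
  fin_cases i
  · simp [slope]
    linear_combination (k * Real.cos (k * x.1) / 2) * h2
  · simp [slope]
    linear_combination (k * Real.sin (k * x.1) / 2) * h2
  · simp

theorem partialD_one_frameOne (k : ℕ) : partialD 1 (frameOne k) = 0 :=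
  partialD_one_of_lift (g := fun t => !₂[-Real.sin (k * t), Real.cos (k * t), 0])
    (frameOne_cover k)

theorem partialD_zero_frameTwo (k : ℕ) : partialD 0 (frameTwo k) = slope k • frameOne k := by
  funext p
  obtain ⟨x, rfl⟩ := exists_cover p
  rw [partialD_zero_of_lift (g := fun t => !₂[√2 / 2 * Real.cos (k * t),
    √2 / 2 * Real.sin (k * t), -(√2 / 2)]) (frameTwo_cover k) x
    (hasDerivAt_vec3 ((hasDerivAt_cos_nat_mul k _).const_mul _)
      ((hasDerivAt_sin_nat_mul k _).const_mul _) (hasDerivAt_const _ _)), Pi.smul_apply,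
    frameOne_cover]
  ext i
  fin_cases i <;> simp [slope] <;> ring

theorem partialD_one_frameTwo (k : ℕ) : partialD 1 (frameTwo k) = 0 :=
  partialD_one_of_lift (g := fun t => !₂[√2 / 2 * Real.cos (k * t),
    √2 / 2 * Real.sin (k * t), -(√2 / 2)]) (frameTwo_cover k)

theorem ip_zero_right (A : Torus → E3) : ip A 0 = 0 := by
  funext p; simp [ip]

theorem ip_zero_left (A : Torus → E3) : ip 0 A = 0 := by
  funext p; simp [ip]

theorem ip_sub_left (A B C : Torus → E3) : ip (A - B) C = ip A C - ip B C := by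
  funext p; simp [ip, inner_sub_left]

theorem ip_field_smul_left (f : Torus → ℝ) (A B : Torus → E3) : ip (f • A) B = f * ip A B := by
  funext p; simp [ip, real_inner_smul_left]

theorem ip_field_smul_right (f : Torus → ℝ) (A B : Torus → E3) : ip A (f • B) = f * ip A B := by
  rw [ip_comm, ip_field_smul_left, ip_comm]

theorem ip_tangential {φ : SmoothMap} (V : Torus → E3) {W : Torus → E3} (hW : ip φ.vec W = 0) :
    ip (tangential φ V) W = ip V W := by
  rw [tangential, ip_sub_left, ip_field_smul_left, hW, mul_zero, sub_zero]

/-! ### The connection and the iterated Jacobi operator in the frame -/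

section coefficients

variable {k : ℕ} {V : Torus → E3}

/-- Leibniz rule: the frame component of the derivative is the derivative of the component minus the
product of `V` with the derivative of the frame vector, whose normal part `V` does not see. The
constant `slope k` is the connection form of the frame. -/
theorem ip_nabla_zero_frameOne (hV : IsSection (phi k) V) : ip (nabla (phi k) 0 V) (frameOne k)
    = partialD 0 (ip V (frameOne k)) + slope k • ip V (frameTwo k) := by
  rw [nabla, ip_tangential _ (ip_vec_frameOne k), partialD_ip hV.1 (torusSmooth_frameOne k),
    partialD_zero_frameOne, ip_smul_right, ip_add_right, hV.ip_vec, zero_add, neg_smul]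
  abel

theorem ip_nabla_zero_frameTwo (hV : IsSection (phi k) V) : ip (nabla (phi k) 0 V) (frameTwo k)
    = partialD 0 (ip V (frameTwo k)) - slope k • ip V (frameOne k) := by
  rw [nabla, ip_tangential _ (ip_vec_frameTwo k), partialD_ip hV.1 (torusSmooth_frameTwo k),
    partialD_zero_frameTwo, ip_smul_right]
  abel

theorem ip_nabla_one_frameOne (hV : IsSection (phi k) V) : ip (nabla (phi k) 1 V) (frameOne k)
    = partialD 1 (ip V (frameOne k)) := by
  rw [nabla, ip_tangential _ (ip_vec_frameOne k), partialD_ip hV.1 (torusSmooth_frameOne k),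
    partialD_one_frameOne, ip_zero_right, add_zero]

theorem ip_nabla_one_frameTwo (hV : IsSection (phi k) V) : ip (nabla (phi k) 1 V) (frameTwo k)
    = partialD 1 (ip V (frameTwo k)) := by
  rw [nabla, ip_tangential _ (ip_vec_frameTwo k), partialD_ip hV.1 (torusSmooth_frameTwo k),
    partialD_one_frameTwo, ip_zero_right, add_zero]

theorem nabla_zero_right (φ : SmoothMap) (i : Fin 2) : nabla φ i 0 = 0 := by
  funext p
  simp [nabla, tangential, partialD, ip]

theorem nabla_zero_frameOne (k : ℕ) : nabla (phi k) 0 (frameOne k) = -slope k • frameTwo k := by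
  rw [((isSection_frameOne k).nabla 0).eq_frame, ip_nabla_zero_frameOne (isSection_frameOne k),
    ip_nabla_zero_frameTwo (isSection_frameOne k), ip_frameOne_frameTwo, ip_frameOne_frameOne]
  funext p
  simp [partialD]

theorem nabla_zero_frameTwo (k : ℕ) : nabla (phi k) 0 (frameTwo k) = slope k • frameOne k := by
  rw [((isSection_frameTwo k).nabla 0).eq_frame, ip_nabla_zero_frameOne (isSection_frameTwo k),
    ip_nabla_zero_frameTwo (isSection_frameTwo k), ip_frameTwo_frameOne, ip_frameTwo_frameTwo]
  funext p
  simp [partialD]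

theorem nabla_one_frameTwo (k : ℕ) : nabla (phi k) 1 (frameTwo k) = 0 := by
  rw [nabla, partialD_one_frameTwo]
  funext p
  simp [tangential, ip]

theorem tension_phi (k : ℕ) : tension (phi k) = -slope k ^ 2 • frameTwo k := by
  rw [tension, Fin.sum_univ_two, dmap_zero, dmap_one, nabla_zero_right, add_zero,
    nabla_const_smul _ (isSection_frameOne k), nabla_zero_frameOne, smul_smul]
  congr 1; ring

theorem dsec_tension_zero (k : ℕ) :
    dsec (phi k) (tension (phi k)) 0 = -slope k ^ 3 • frameOne k := by
  rw [dsec, tension_phi, nabla_const_smul _ (isSection_frameTwo k), nabla_zero_frameTwo, smul_smul]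
  congr 1; ring

theorem dsec_tension_one (k : ℕ) : dsec (phi k) (tension (phi k)) 1 = 0 := by
  rw [dsec, tension_phi, nabla_const_smul _ (isSection_frameTwo k), nabla_one_frameTwo, smul_zero]

/-- The argument of the second rough Laplacian in `I₂(V)`. -/
def curvatureTerm (k : ℕ) (V : Torus → E3) : Torus → E3 :=
  traceForm (cst V) (dmap (phi k)) (dmap (phi k)) - ipForm (dmap (phi k)) (dmap (phi k)) • V

theorem isSection_curvatureTerm (hV : IsSection (phi k) V) :
    IsSection (phi k) (curvatureTerm k V) :=
  have hd := isSection_dmap (phi k)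
  (IsSection.traceForm hV.cst hd hd).sub (hV.smul (TorusSmooth.ipForm hd hd))

/-- The differential has rank one with image along `frameOne`, so the trace is $|d\varphi|^2$ times
the projection to `frameOne`, and subtracting $|d\varphi|^2V$ leaves only the `frameTwo` component.
-/
theorem ip_curvatureTerm_frameOne : ip (curvatureTerm k V) (frameOne k) = 0 := by
  simp only [curvatureTerm, traceForm, ipForm, Fin.sum_univ_two, dmap_zero, dmap_one, cst,
    ip_sub_left, ip_add_left, ip_smul_left, ip_smul_right, ip_field_smul_left, ip_zero_right,
    ip_frameOne_frameOne]
  funext p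
  simp

theorem ip_curvatureTerm_frameTwo :
    ip (curvatureTerm k V) (frameTwo k) = -slope k ^ 2 • ip V (frameTwo k) := by
  simp only [curvatureTerm, traceForm, ipForm, Fin.sum_univ_two, dmap_zero, dmap_one, cst,
    ip_sub_left, ip_add_left, ip_smul_left, ip_smul_right, ip_field_smul_left, ip_zero_right,
    ip_frameOne_frameOne, ip_frameOne_frameTwo]
  funext p
  simp; ring

/-- Along `frameOne` the two second-order terms $\operatorname{trace}\langle
d\varphi,\overline\Delta V\rangle d\varphi$ and $-|d\varphi|^2\overline\Delta V$ cancel; along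
`frameTwo` only the latter contributes, which explains the extra summand in the companion formula.
-/
theorem ip_jacobiField_frameOne : ip (jacobiField (phi k) V) (frameOne k)
    = ip (roughLaplacian (phi k) (roughLaplacian (phi k) V)) (frameOne k)
      + ip (roughLaplacian (phi k) (curvatureTerm k V)) (frameOne k)
      + slope k ^ 4 • ip V (frameOne k)
      + (2 * slope k ^ 3) • ip (nabla (phi k) 0 V) (frameTwo k) := by
  unfold jacobiField
  rw [← curvatureTerm]
  simp only [traceForm, ipForm, Fin.sum_univ_two, dsec_tension_zero, dsec_tension_one]
  simp only [tension_phi, dmap_zero, dmap_one, cst,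
    ip_sub_left, ip_add_left, ip_smul_left, ip_smul_right, ip_field_smul_left, ip_zero_right,
    ip_add_right, ip_field_smul_right, ip_zero_left, ip_frameOne_frameOne, ip_frameTwo_frameOne,
    ip_frameTwo_frameTwo, ip_comm (frameOne k) (roughLaplacian (phi k) V),
    ip_comm (frameOne k) V, ip_comm (frameTwo k) V, ip_comm (frameTwo k) (dsec (phi k) V 0)]
  simp only [dsec]
  funext p
  simp; ring

theorem ip_jacobiField_frameTwo : ip (jacobiField (phi k) V) (frameTwo k)
    = ip (roughLaplacian (phi k) (roughLaplacian (phi k) V)) (frameTwo k)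
      + ip (roughLaplacian (phi k) (curvatureTerm k V)) (frameTwo k)
      + (-slope k ^ 4) • ip V (frameTwo k)
      + (-2 * slope k ^ 3) • ip (nabla (phi k) 0 V) (frameOne k)
      + (-slope k ^ 2) • ip (roughLaplacian (phi k) V) (frameTwo k) := by
  unfold jacobiField
  rw [← curvatureTerm]
  simp only [traceForm, ipForm, Fin.sum_univ_two, dsec_tension_zero, dsec_tension_one]
  simp only [tension_phi, dmap_zero, dmap_one, cst,
    ip_sub_left, ip_add_left, ip_smul_left, ip_smul_right, ip_field_smul_left, ip_zero_right,
    ip_add_right, ip_field_smul_right, ip_zero_left, ip_frameOne_frameOne, ip_frameOne_frameTwo,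
    ip_frameTwo_frameTwo, ip_comm (frameOne k) (roughLaplacian (phi k) V),
    ip_comm (frameOne k) V, ip_comm (frameTwo k) V, ip_comm (frameTwo k) (dsec (phi k) V 0)]
  simp only [dsec]
  funext p
  simp; ring

end coefficients

/-! ### The symbol of the iterated Jacobi operator -/

section coefficients

/-- The trigonometric coefficients of the first component of a section. -/
def coeffOne (k : ℕ) (m n : ℤ) (V : Torus → E3) : ℝ := torusCoeff m n (ip V (frameOne k))

/-- The trigonometric coefficients of the second component of a section. -/
def coeffTwo (k : ℕ) (m n : ℤ) (V : Torus → E3) : ℝ := torusCoeff m n (ip V (frameTwo k))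

variable {k : ℕ} {V : Torus → E3}

theorem torusCoeff_ip_frameOne (m n : ℤ) :
    torusCoeff m n (ip V (frameOne k)) = coeffOne k m n V := rfl

theorem torusCoeff_ip_frameTwo (m n : ℤ) :
    torusCoeff m n (ip V (frameTwo k)) = coeffTwo k m n V := rfl

theorem IsSection.torusSmooth_ip_frameOne (hV : IsSection (phi k) V) :
    TorusSmooth (ip V (frameOne k)) := hV.1.ip (torusSmooth_frameOne k)

theorem IsSection.torusSmooth_ip_frameTwo (hV : IsSection (phi k) V) :
    TorusSmooth (ip V (frameTwo k)) := hV.1.ip (torusSmooth_frameTwo k)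

theorem coeffOne_add {W : Torus → E3} (hV : IsSection (phi k) V) (hW : IsSection (phi k) W)
    (m n : ℤ) : coeffOne k m n (V + W) = coeffOne k m n V + coeffOne k m n W := by
  rw [coeffOne, ip_add_left, torusCoeff_add _ _ hV.torusSmooth_ip_frameOne
    hW.torusSmooth_ip_frameOne]; rfl

theorem coeffTwo_add {W : Torus → E3} (hV : IsSection (phi k) V) (hW : IsSection (phi k) W)
    (m n : ℤ) : coeffTwo k m n (V + W) = coeffTwo k m n V + coeffTwo k m n W := by
  rw [coeffTwo, ip_add_left, torusCoeff_add _ _ hV.torusSmooth_ip_frameTwo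
    hW.torusSmooth_ip_frameTwo]; rfl

theorem coeffOne_smul (c : ℝ) (m n : ℤ) : coeffOne k m n (c • V) = c * coeffOne k m n V := by
  rw [coeffOne, ip_smul_left, torusCoeff_smul]; rfl

theorem coeffTwo_smul (c : ℝ) (m n : ℤ) : coeffTwo k m n (c • V) = c * coeffTwo k m n V := by
  rw [coeffTwo, ip_smul_left, torusCoeff_smul]; rfl

theorem coeffOne_nabla_zero (hV : IsSection (phi k) V) (m n : ℤ) :
    coeffOne k m n (nabla (phi k) 0 V) = -m * coeffOne k (-m) n V + slope k * coeffTwo k m n V := by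
  rw [coeffOne, ip_nabla_zero_frameOne hV, torusCoeff_add _ _
    (hV.torusSmooth_ip_frameOne.partialD 0) (hV.torusSmooth_ip_frameTwo.const_smul _),
    torusCoeff_smul, torusCoeff_partialD_zero _ _ hV.torusSmooth_ip_frameOne]
  rfl

theorem coeffTwo_nabla_zero (hV : IsSection (phi k) V) (m n : ℤ) :
    coeffTwo k m n (nabla (phi k) 0 V) = -m * coeffTwo k (-m) n V - slope k * coeffOne k m n V := by
  rw [coeffTwo, ip_nabla_zero_frameTwo hV, sub_eq_add_neg, ← neg_smul, torusCoeff_add _ _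
    (hV.torusSmooth_ip_frameTwo.partialD 0) (hV.torusSmooth_ip_frameOne.const_smul _),
    torusCoeff_smul, torusCoeff_partialD_zero _ _ hV.torusSmooth_ip_frameTwo,
    neg_mul (slope k), ← sub_eq_add_neg]
  rfl

theorem coeffOne_nabla_one (hV : IsSection (phi k) V) (m n : ℤ) :
    coeffOne k m n (nabla (phi k) 1 V) = -n * coeffOne k m (-n) V := by
  rw [coeffOne, ip_nabla_one_frameOne hV,
    torusCoeff_partialD_one _ _ hV.torusSmooth_ip_frameOne]
  rfl

theorem coeffTwo_nabla_one (hV : IsSection (phi k) V) (m n : ℤ) :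
    coeffTwo k m n (nabla (phi k) 1 V) = -n * coeffTwo k m (-n) V := by
  rw [coeffTwo, ip_nabla_one_frameTwo hV,
    torusCoeff_partialD_one _ _ hV.torusSmooth_ip_frameTwo]
  rfl

/-- Two $\gamma$-derivatives reflect `m` twice and restore it. The cross term contains a single
derivative, from the rotation of the frame, and so picks up the frequency `-m` of the other
component. -/
theorem coeffOne_roughLaplacian (hV : IsSection (phi k) V) (m n : ℤ) :
    coeffOne k m n (roughLaplacian (phi k) V)
      = ((m : ℝ) ^ 2 + (n : ℝ) ^ 2 + slope k ^ 2) * coeffOne k m n V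
        + 2 * slope k * m * coeffTwo k (-m) n V := by
  rw [roughLaplacian, Fin.sum_univ_two, ← neg_one_smul ℝ, coeffOne_smul,
    coeffOne_add ((hV.nabla 0).nabla 0) ((hV.nabla 1).nabla 1),
    coeffOne_nabla_zero (hV.nabla 0), coeffOne_nabla_zero hV, coeffTwo_nabla_zero hV,
    coeffOne_nabla_one (hV.nabla 1), coeffOne_nabla_one hV, neg_neg, neg_neg]
  push_cast
  ring

theorem coeffTwo_roughLaplacian (hV : IsSection (phi k) V) (m n : ℤ) :
    coeffTwo k m n (roughLaplacian (phi k) V)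
      = ((m : ℝ) ^ 2 + (n : ℝ) ^ 2 + slope k ^ 2) * coeffTwo k m n V
        - 2 * slope k * m * coeffOne k (-m) n V := by
  rw [roughLaplacian, Fin.sum_univ_two, ← neg_one_smul ℝ, coeffTwo_smul,
    coeffTwo_add ((hV.nabla 0).nabla 0) ((hV.nabla 1).nabla 1),
    coeffTwo_nabla_zero (hV.nabla 0), coeffTwo_nabla_zero hV, coeffOne_nabla_zero hV,
    coeffTwo_nabla_one (hV.nabla 1), coeffTwo_nabla_one hV, neg_neg, neg_neg]
  push_cast
  ring

theorem coeffOne_curvatureTerm (m n : ℤ) : coeffOne k m n (curvatureTerm k V) = 0 := by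
  rw [coeffOne, ip_curvatureTerm_frameOne, ← zero_smul ℝ (0 : Torus → ℝ), torusCoeff_smul,
    zero_mul]

theorem coeffTwo_curvatureTerm (m n : ℤ) :
    coeffTwo k m n (curvatureTerm k V) = -slope k ^ 2 * coeffTwo k m n V := by
  rw [coeffTwo, ip_curvatureTerm_frameTwo, torusCoeff_smul]; rfl

/-- The `(1,1)` entry of the symbol of `I₂`. -/
def symbolOne (k : ℕ) (x y : ℝ) : ℝ :=
  (x ^ 2 + y ^ 2) ^ 2 + k ^ 2 * (x ^ 2 + y ^ 2) + 2 * k ^ 2 * x ^ 2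

/-- The `(2,2)` entry of the symbol of `I₂`. -/
def symbolTwo (k : ℕ) (x y : ℝ) : ℝ := (x ^ 2 + y ^ 2) ^ 2 - k ^ 4 + 2 * k ^ 2 * x ^ 2

/-- The off-diagonal entry of the symbol of `I₂`. -/
def symbolMixed (k : ℕ) (x y : ℝ) : ℝ := 4 * slope k * x * (x ^ 2 + y ^ 2)

/-- With the companion formula for `coeffTwo k (-m) n`, this is a closed 2×2 system for each
$(m,n)$. The matrix is symmetric, so its eigenvectors also serve as functionals. -/
theorem coeffOne_jacobiField (hV : IsSection (phi k) V) (m n : ℤ) :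
    coeffOne k m n (jacobiField (phi k) V)
      = symbolOne k m n * coeffOne k m n V + symbolMixed k m n * coeffTwo k (-m) n V := by
  have hL := hV.roughLaplacian
  have hC := isSection_curvatureTerm hV
  rw [coeffOne, ip_jacobiField_frameOne, torusCoeff_add, torusCoeff_add, torusCoeff_add,
    torusCoeff_smul, torusCoeff_smul]
  · simp only [torusCoeff_ip_frameOne, torusCoeff_ip_frameTwo]
    rw [coeffOne_roughLaplacian hL, coeffOne_roughLaplacian hV, coeffTwo_roughLaplacian hV,
      coeffOne_roughLaplacian hC, coeffOne_curvatureTerm, coeffTwo_curvatureTerm,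
      coeffTwo_nabla_zero hV, neg_neg]
    have ha := slope_sq k
    simp only [symbolOne, symbolMixed]
    push_cast
    -- `slope_sq` replaces even powers of the slope by powers of `k`; the odd power survives in
    -- `symbolMixed`.
    linear_combination (2 * ((m : ℝ) ^ 2 + n ^ 2) + 4 * (m : ℝ) ^ 2) * coeffOne k m n V * ha
  · exact hL.roughLaplacian.torusSmooth_ip_frameOne
  · exact hC.roughLaplacian.torusSmooth_ip_frameOne
  · exact hL.roughLaplacian.torusSmooth_ip_frameOne.add hC.roughLaplacian.torusSmooth_ip_frameOne
  · exact hV.torusSmooth_ip_frameOne.const_smul _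
  · exact (hL.roughLaplacian.torusSmooth_ip_frameOne.add
      hC.roughLaplacian.torusSmooth_ip_frameOne).add (hV.torusSmooth_ip_frameOne.const_smul _)
  · exact (hV.nabla 0).torusSmooth_ip_frameTwo.const_smul _

theorem coeffTwo_jacobiField (hV : IsSection (phi k) V) (m n : ℤ) :
    coeffTwo k (-m) n (jacobiField (phi k) V)
      = symbolMixed k m n * coeffOne k m n V + symbolTwo k m n * coeffTwo k (-m) n V := by
  have hL := hV.roughLaplacian
  have hC := isSection_curvatureTerm hV
  have h1 := hL.roughLaplacian.torusSmooth_ip_frameTwo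
  have h2 := hC.roughLaplacian.torusSmooth_ip_frameTwo
  have h3 := hV.torusSmooth_ip_frameTwo.const_smul (-slope k ^ 4)
  have h4 := (hV.nabla 0).torusSmooth_ip_frameOne.const_smul (-2 * slope k ^ 3)
  have h5 := hL.torusSmooth_ip_frameTwo.const_smul (-slope k ^ 2)
  rw [coeffTwo, ip_jacobiField_frameTwo, torusCoeff_add _ _ (((h1.add h2).add h3).add h4) h5,
    torusCoeff_add _ _ ((h1.add h2).add h3) h4, torusCoeff_add _ _ (h1.add h2) h3,
    torusCoeff_add _ _ h1 h2, torusCoeff_smul, torusCoeff_smul, torusCoeff_smul]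
  simp only [torusCoeff_ip_frameOne, torusCoeff_ip_frameTwo]
  rw [coeffTwo_roughLaplacian hL, coeffTwo_roughLaplacian hV, coeffOne_roughLaplacian hV,
    coeffTwo_roughLaplacian hC, coeffOne_curvatureTerm, coeffTwo_curvatureTerm,
    coeffOne_nabla_zero hV, neg_neg]
  have ha := slope_sq k
  simp only [symbolTwo, symbolMixed]
  push_cast
  linear_combination (4 * (m : ℝ) ^ 2 - 4 * slope k ^ 2 - 2 * k ^ 2) * coeffTwo k (-m) n V * ha

theorem IsSection.eq_zero_of_coeff_eq_zero (hV : IsSection (phi k) V)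
    (h1 : ∀ m n, coeffOne k m n V = 0) (h2 : ∀ m n, coeffTwo k m n V = 0) : V = 0 := by
  rw [hV.eq_frame, eq_zero_of_torusCoeff_eq_zero hV.torusSmooth_ip_frameOne h1,
    eq_zero_of_torusCoeff_eq_zero hV.torusSmooth_ip_frameTwo h2, zero_smul, zero_smul, add_zero]

/-- The section with components `p cas m γ cas n ϑ` and `q cas (-m) γ cas n ϑ`. -/
def modeSection (k : ℕ) (m n : ℤ) (p q : ℝ) : Torus → E3 :=
  (p • casFun m n) • frameOne k + (q • casFun (-m) n) • frameTwo k

theorem isSection_modeSection (k : ℕ) (m n : ℤ) (p q : ℝ) :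
    IsSection (phi k) (modeSection k m n p q) :=
  ((isSection_frameOne k).smul ((torusSmooth_casFun m n).const_smul p)).add
    ((isSection_frameTwo k).smul ((torusSmooth_casFun (-m) n).const_smul q))

theorem coeffOne_modeSection (k : ℕ) (m n m' n' : ℤ) (p q : ℝ) :
    coeffOne k m n (modeSection k m' n' p q)
      = if (m', n') = (m, n) then p * (2 * Real.pi) ^ 2 else 0 := by
  rw [coeffOne, modeSection, ip_add_left, ip_field_smul_left, ip_field_smul_left,
    ip_frameOne_frameOne, ip_frameTwo_frameOne, mul_one, mul_zero, add_zero, torusCoeff_smul,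
    torusCoeff_casFun]
  simp only [Prod.mk.injEq, mul_ite, mul_zero]

theorem coeffTwo_modeSection (k : ℕ) (m n m' n' : ℤ) (p q : ℝ) :
    coeffTwo k (-m) n (modeSection k m' n' p q)
      = if (m', n') = (m, n) then q * (2 * Real.pi) ^ 2 else 0 := by
  rw [coeffTwo, modeSection, ip_add_left, ip_field_smul_left, ip_field_smul_left,
    ip_frameTwo_frameTwo, ip_frameOne_frameTwo, mul_one, mul_zero, zero_add, torusCoeff_smul,
    torusCoeff_casFun]
  simp only [Prod.mk.injEq, mul_ite, mul_zero, neg_inj]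

end coefficients

/-! ### Eigenspace dimensions and the signs of the two eigenvalues -/

section spectral

/-- An operator with a total family of functionals that are eigenvectors of the transpose, and a
biorthogonal family of vectors, has eigenspaces of the expected dimension. -/
theorem rank_eigenspace_of_biorthogonal {M ι : Type} [AddCommGroup M] [Module ℝ M]
    (T : Module.End ℝ M) (w : ι → M) (l : ι → M →ₗ[ℝ] ℝ) (ev : ι → ℝ)
    (hT : ∀ i V, l i (T V) = ev i * l i V) (hne : ∀ i, l i (w i) ≠ 0)
    (hort : ∀ i j, i ≠ j → l i (w j) = 0) (htot : ∀ V, (∀ i, l i V = 0) → V = 0)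
    (μ : ℝ) (hfin : Finite {i // ev i = μ}) :
    Module.rank ℝ (Module.End.eigenspace T μ) = Cardinal.mk {i // ev i = μ} := by
  classical
  have := Fintype.ofFinite {i // ev i = μ}
  let L : Module.End.eigenspace T μ →ₗ[ℝ] ({i // ev i = μ} → ℝ) :=
    LinearMap.pi fun i => (l i).comp (Module.End.eigenspace T μ).subtype
  -- Every functional annihilates `T (w i) - ev i • w i`, so totality makes each `w i` an honest
  -- eigenvector.
  have hw : ∀ i, T (w i) = ev i • w i := by
    intro i
    refine sub_eq_zero.1 (htot _ fun j => ?_)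
    rw [map_sub, hT, map_smul, smul_eq_mul]
    rcases eq_or_ne j i with rfl | hij
    · ring
    · rw [hort j i hij]; ring
  -- A functional with eigenvalue different from `μ` vanishes on the `μ`-eigenspace, so those kept
  -- in `L` already separate its points.
  have hinj : Function.Injective L := by
    rw [injective_iff_map_eq_zero]
    intro V hV
    refine Subtype.ext (htot _ fun i => ?_)
    by_cases hi : ev i = μ
    · exact congrFun hV ⟨i, hi⟩
    · have h := hT i V
      rw [Module.End.mem_eigenspace_iff.1 V.2, map_smul, smul_eq_mul] at h
      have h' : (ev i - μ) * l i V = 0 := by linarith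
      exact (mul_eq_zero.1 h').resolve_left (sub_ne_zero.2 hi)
  have hsurj : Function.Surjective L := by
    intro c
    refine ⟨⟨∑ i, (c i / l i (w i)) • w i, ?_⟩, ?_⟩
    · refine Submodule.sum_mem _ fun i _ => Submodule.smul_mem _ _ ?_
      rw [Module.End.mem_eigenspace_iff, hw, i.2]
    · funext j
      simp only [L, LinearMap.pi_apply, LinearMap.comp_apply, Submodule.subtype_apply, map_sum,
        map_smul, smul_eq_mul]
      rw [Finset.sum_eq_single j (fun i _ hij => by
        rw [hort _ _ (fun h => hij (Subtype.ext h.symm)), mul_zero]) (by simp)]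
      exact div_mul_cancel₀ _ (hne j)
  rw [(LinearEquiv.ofBijective L ⟨hinj, hsurj⟩).rank_eq, rank_fun', Cardinal.mk_fintype]

/-- The larger eigenvalue of the symbol. -/
def lambdaPlus (k m n : ℕ) : ℝ :=
  (1 / 2) * (-(k : ℝ) ^ 4 + (k : ℝ) ^ 2 * (5 * (m : ℝ) ^ 2 + (n : ℝ) ^ 2)
    + 2 * ((m : ℝ) ^ 2 + (n : ℝ) ^ 2) ^ 2
    + √((k : ℝ) ^ 8 + 2 * (k : ℝ) ^ 6 * ((m : ℝ) ^ 2 + (n : ℝ) ^ 2)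
        + (k : ℝ) ^ 4 * ((m : ℝ) ^ 2 + (n : ℝ) ^ 2) ^ 2
        + 32 * (k : ℝ) ^ 2 * (m : ℝ) ^ 2 * ((m : ℝ) ^ 2 + (n : ℝ) ^ 2) ^ 2))

/-- The first component of an eigenvector of the symbol for `lambdaPlus`; the second is
`2 * symbolMixed`. -/
def eigenvectorOne (k m n : ℕ) : ℝ := 2 * (lambdaPlus k m n - symbolTwo k m n)

theorem symbolMixed_sq (k : ℕ) (x y : ℝ) :
    symbolMixed k x y ^ 2 = 8 * k ^ 2 * x ^ 2 * (x ^ 2 + y ^ 2) ^ 2 := by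
  simp only [symbolMixed, mul_pow, slope_sq]; ring

/-- Trace of the symbol; `lambda_mul` is its determinant. Together they say that the explicit
square-root expressions are the eigenvalues. -/
theorem lambda_add (k m n : ℕ) :
    lambdaPlus k m n + lambdaMinus k m n = symbolOne k m n + symbolTwo k m n := by
  simp only [lambdaPlus, lambdaMinus, symbolOne, symbolTwo]; ring

theorem lambda_mul (k m n : ℕ) : lambdaPlus k m n * lambdaMinus k m n
    = symbolOne k m n * symbolTwo k m n - symbolMixed k m n ^ 2 := by
  have h := Real.sq_sqrt (x := (k : ℝ) ^ 8 + 2 * (k : ℝ) ^ 6 * ((m : ℝ) ^ 2 + (n : ℝ) ^ 2)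
        + (k : ℝ) ^ 4 * ((m : ℝ) ^ 2 + (n : ℝ) ^ 2) ^ 2
        + 32 * (k : ℝ) ^ 2 * (m : ℝ) ^ 2 * ((m : ℝ) ^ 2 + (n : ℝ) ^ 2) ^ 2) (by positivity)
  rw [symbolMixed_sq]
  simp only [lambdaPlus, lambdaMinus, symbolOne, symbolTwo]
  linear_combination (-1 / 4) * h

/-- The radicand is $(A-D)^2+4B^2$ for the matrix with diagonal $A,D$ and off-diagonal $B$. Here
$A-D=k^4+k^2(m^2+n^2)\ge0$, so the root is at least $A-D$. -/
theorem symbolOne_le_lambdaPlus (k m n : ℕ) : symbolOne k m n ≤ lambdaPlus k m n := by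
  have h : (k : ℝ) ^ 4 + (k : ℝ) ^ 2 * ((m : ℝ) ^ 2 + (n : ℝ) ^ 2)
      ≤ √((k : ℝ) ^ 8 + 2 * (k : ℝ) ^ 6 * ((m : ℝ) ^ 2 + (n : ℝ) ^ 2)
        + (k : ℝ) ^ 4 * ((m : ℝ) ^ 2 + (n : ℝ) ^ 2) ^ 2
        + 32 * (k : ℝ) ^ 2 * (m : ℝ) ^ 2 * ((m : ℝ) ^ 2 + (n : ℝ) ^ 2) ^ 2) := by
    refine Real.le_sqrt_of_sq_le ?_
    have : 0 ≤ 32 * (k : ℝ) ^ 2 * (m : ℝ) ^ 2 * ((m : ℝ) ^ 2 + (n : ℝ) ^ 2) ^ 2 := by positivity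
    linarith
  simp only [lambdaPlus, symbolOne]
  linarith

theorem lambdaPlus_pos {k m n : ℕ} (h : m ≠ 0 ∨ n ≠ 0) : 0 < lambdaPlus k m n := by
  refine lt_of_lt_of_le ?_ (symbolOne_le_lambdaPlus k m n)
  have : 0 < (m : ℝ) ^ 2 + (n : ℝ) ^ 2 := by rcases h with h | h <;> positivity
  unfold symbolOne
  positivity

theorem lambdaPlus_zero_zero (k : ℕ) : lambdaPlus k 0 0 = 0 := by
  have h : √((k : ℝ) ^ 8) = (k : ℝ) ^ 4 := by
    rw [show (k : ℝ) ^ 8 = (k ^ 4) ^ 2 by ring, Real.sqrt_sq (by positivity)]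
  simp [lambdaPlus, h]

/-- For $m=0$ the symbol is diagonal and the smaller eigenvalue is `symbolTwo`. -/
theorem lambdaMinus_zero_left (k n : ℕ) : lambdaMinus k 0 n = (n : ℝ) ^ 4 - (k : ℝ) ^ 4 := by
  have h : √((k : ℝ) ^ 8 + 2 * (k : ℝ) ^ 6 * (n : ℝ) ^ 2 + (k : ℝ) ^ 4 * ((n : ℝ) ^ 2) ^ 2)
      = (k : ℝ) ^ 4 + (k : ℝ) ^ 2 * (n : ℝ) ^ 2 := by
    rw [← Real.sqrt_sq (show 0 ≤ (k : ℝ) ^ 4 + (k : ℝ) ^ 2 * (n : ℝ) ^ 2 by positivity)]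
    congr 1; ring
  simp [lambdaMinus, h]
  ring

theorem lambdaPlus_mul_lambdaMinus_zero_right (k m : ℕ) :
    lambdaPlus k m 0 * lambdaMinus k m 0 = (m : ℝ) ^ 2 * ((m : ℝ) ^ 2 - (k : ℝ) ^ 2)
      * (((m : ℝ) ^ 2 - (k : ℝ) ^ 2) ^ 2 + 2 * (k : ℝ) ^ 4) := by
  rw [lambda_mul, symbolMixed_sq]
  simp only [symbolOne, symbolTwo, Nat.cast_zero]
  ring

theorem lambdaMinus_zero_left_neg_iff {k n : ℕ} : lambdaMinus k 0 n < 0 ↔ n < k := by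
  rw [lambdaMinus_zero_left, sub_neg, pow_lt_pow_iff_left₀ (by positivity) (by positivity)
    (by norm_num), Nat.cast_lt]

theorem lambdaMinus_zero_left_eq_zero_iff {k n : ℕ} : lambdaMinus k 0 n = 0 ↔ n = k := by
  rw [lambdaMinus_zero_left, sub_eq_zero, pow_left_inj₀ (by positivity) (by positivity)
    (by norm_num), Nat.cast_inj]

/-- On this axis the determinant factors with $m^2-k^2$ as the only factor of variable sign;
dividing by the positive `lambdaPlus` gives the sign of `lambdaMinus`. -/
theorem lambdaMinus_zero_right_eq {k m : ℕ} (hk : 1 ≤ k) (hm : 1 ≤ m) :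
    ∃ c : ℝ, 0 < c ∧ lambdaMinus k m 0 = c * ((m : ℝ) ^ 2 - (k : ℝ) ^ 2) := by
  have hp : 0 < lambdaPlus k m 0 := lambdaPlus_pos (Or.inl (by lia))
  have hk' : (0 : ℝ) < k := by exact_mod_cast hk
  have hm' : (0 : ℝ) < m := by exact_mod_cast hm
  refine ⟨(m : ℝ) ^ 2 * (((m : ℝ) ^ 2 - (k : ℝ) ^ 2) ^ 2 + 2 * (k : ℝ) ^ 4) / lambdaPlus k m 0,
    by positivity, ?_⟩
  have h := lambdaPlus_mul_lambdaMinus_zero_right k m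
  field_simp
  linarith

theorem lambdaMinus_zero_right_neg_iff {k m : ℕ} (hk : 1 ≤ k) (hm : 1 ≤ m) :
    lambdaMinus k m 0 < 0 ↔ m < k := by
  obtain ⟨c, hc, h⟩ := lambdaMinus_zero_right_eq hk hm
  rw [h, ← not_le, mul_nonneg_iff_of_pos_left hc, not_le, sub_neg,
    pow_lt_pow_iff_left₀ (by positivity) (by positivity)
    (by norm_num), Nat.cast_lt]

theorem lambdaMinus_zero_right_eq_zero_iff {k m : ℕ} (hk : 1 ≤ k) (hm : 1 ≤ m) :
    lambdaMinus k m 0 = 0 ↔ m = k := by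
  obtain ⟨c, hc, h⟩ := lambdaMinus_zero_right_eq hk hm
  rw [h, mul_eq_zero_iff_left hc.ne', sub_eq_zero, pow_left_inj₀ (by positivity) (by positivity)
    (by norm_num), Nat.cast_inj]

/-- Outside the box $m^2+n^2\ge4k^2$, which makes the determinant positive; since `lambdaPlus` is
positive, so is `lambdaMinus`. This confines the nonpositive eigenvalues to finitely many modes. -/
theorem le_of_lambdaMinus_nonpos {k m n : ℕ} (hk : 1 ≤ k) (h : lambdaMinus k m n ≤ 0) :
    m ≤ 2 * k ∧ n ≤ 2 * k := by
  by_contra hcon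
  have hk' : (1 : ℝ) ≤ k := by exact_mod_cast hk
  have hs : 4 * (k : ℝ) ^ 2 ≤ (m : ℝ) ^ 2 + (n : ℝ) ^ 2 := by
    rcases not_and_or.1 hcon with h1 | h1
    · have : 2 * (k : ℝ) ≤ m := by exact_mod_cast (not_le.1 h1).le
      nlinarith [sq_nonneg (n : ℝ)]
    · have : 2 * (k : ℝ) ≤ n := by exact_mod_cast (not_le.1 h1).le
      nlinarith [sq_nonneg (m : ℝ)]
  have hpos : 0 < lambdaPlus k m n := lambdaPlus_pos (by lia)
  have hdet := lambda_mul k m n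
  have hle : lambdaPlus k m n * lambdaMinus k m n ≤ 0 := mul_nonpos_of_nonneg_of_nonpos hpos.le h
  rw [hdet, symbolMixed_sq] at hle
  simp only [symbolOne, symbolTwo] at hle
  have hm : (m : ℝ) ^ 2 ≤ (m : ℝ) ^ 2 + (n : ℝ) ^ 2 := by linarith [sq_nonneg (n : ℝ)]
  have hm0 := sq_nonneg (m : ℝ)
  have hk2 : (1 : ℝ) ≤ (k : ℝ) ^ 2 := by nlinarith
  rw [show (k : ℝ) ^ 4 = ((k : ℝ) ^ 2) ^ 2 by ring] at hle
  -- What remains is a polynomial inequality in $s=m^2+n^2$, $x=m^2$, $\kappa=k^2$ with $0\le x\le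
  -- s$ and $s\ge4\kappa$. The products below bound the determinant from below, and `e6` supplies
  -- strictness.
  generalize (m : ℝ) ^ 2 + (n : ℝ) ^ 2 = s at *
  generalize (m : ℝ) ^ 2 = x at *
  generalize (k : ℝ) ^ 2 = κ at *
  have hs0 : 0 < s := by linarith
  have e1 : 0 ≤ κ * s ^ 2 * (s - x) := by
    have := sub_nonneg.2 hm; positivity
  have e2 : 0 ≤ κ ^ 3 * (s - x) := by
    have := sub_nonneg.2 hm; positivity
  have e3 : 0 ≤ s ^ 3 * (s - 4 * κ) := by
    have := sub_nonneg.2 hs; positivity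
  have e4 : 0 ≤ κ * s ^ 2 * (s - 4 * κ) := by
    have := sub_nonneg.2 hs; positivity
  have e5 : 0 ≤ κ ^ 2 * s * (s - 4 * κ) := by
    have := sub_nonneg.2 hs; positivity
  have e6 : 0 < κ ^ 3 * s := by positivity
  have e7 : 0 ≤ κ ^ 2 * x ^ 2 := by positivity
  nlinarith

end spectral

/-! ### Counting lattice points up to signs -/

section counting

theorem sum_Icc_natAbs (f : ℕ → ℕ) (N : ℕ) :
    ∑ m ∈ Finset.Icc (-(N : ℤ)) N, f m.natAbs = f 0 + 2 * ∑ j ∈ Finset.Icc 1 N, f j := by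
  induction N with
  | zero => simp
  | succ N ih =>
    have h : Finset.Icc (-((N + 1 : ℕ) : ℤ)) ((N + 1 : ℕ) : ℤ)
        = insert (-((N + 1 : ℕ) : ℤ)) (insert ((N + 1 : ℕ) : ℤ) (Finset.Icc (-(N : ℤ)) N)) := by
      ext x; simp only [Finset.mem_insert, Finset.mem_Icc]; lia
    rw [h, Finset.sum_insert (by simp only [Finset.mem_insert, Finset.mem_Icc]; lia),
      Finset.sum_insert (by simp only [Finset.mem_Icc]; lia), ih,
      Finset.sum_Icc_succ_top (by lia), Int.natAbs_neg, Int.natAbs_natCast]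
    ring

/-- Sign changes act on $\mathbb Z^2$ with orbits of size 1 at the origin, 2 on the axes and 4
elsewhere. The first `Set.ncard` is the indicator of `P 0 0`. -/
theorem card_natAbs (P : ℕ → ℕ → Prop) (N : ℕ) (hP : ∀ i j, P i j → i ≤ N ∧ j ≤ N) :
    Nat.card {x : ℤ × ℤ // P x.1.natAbs x.2.natAbs}
      = Set.ncard {i : ℕ | i = 0 ∧ P 0 0} + 2 * Set.ncard {j | 1 ≤ j ∧ P 0 j}
        + 2 * Set.ncard {i | 1 ≤ i ∧ P i 0}
        + 4 * Set.ncard {q : ℕ × ℕ | 1 ≤ q.1 ∧ 1 ≤ q.2 ∧ P q.1 q.2} := by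
  classical
  have h0 : Set.ncard {i : ℕ | i = 0 ∧ P 0 0} = if P 0 0 then 1 else 0 := by
    split_ifs with h <;> simp [h]
  have h1 : Set.ncard {j | 1 ≤ j ∧ P 0 j} = ∑ j ∈ Finset.Icc 1 N, if P 0 j then 1 else 0 := by
    rw [← Finset.card_filter, ← Set.ncard_coe_finset]
    congr 1; ext j
    simp only [Set.mem_ofPred_eq, Finset.coe_filter, Finset.mem_Icc]
    exact ⟨fun h => ⟨⟨h.1, (hP _ _ h.2).2⟩, h.2⟩, fun h => ⟨h.1.1, h.2⟩⟩
  have h2 : Set.ncard {i | 1 ≤ i ∧ P i 0} = ∑ i ∈ Finset.Icc 1 N, if P i 0 then 1 else 0 := by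
    rw [← Finset.card_filter, ← Set.ncard_coe_finset]
    congr 1; ext j
    simp only [Set.mem_ofPred_eq, Finset.coe_filter, Finset.mem_Icc]
    exact ⟨fun h => ⟨⟨h.1, (hP _ _ h.2).1⟩, h.2⟩, fun h => ⟨h.1.1, h.2⟩⟩
  have h3 : Set.ncard {q : ℕ × ℕ | 1 ≤ q.1 ∧ 1 ≤ q.2 ∧ P q.1 q.2}
      = ∑ i ∈ Finset.Icc 1 N, ∑ j ∈ Finset.Icc 1 N, if P i j then 1 else 0 := by
    rw [← Finset.sum_product' _ _ (fun i j => if P i j then 1 else 0), ← Finset.card_filter,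
      ← Set.ncard_coe_finset]
    congr 1; ext q
    simp only [Set.mem_ofPred_eq, Finset.coe_filter, Finset.mem_product, Finset.mem_Icc]
    exact ⟨fun h => ⟨⟨⟨h.1, (hP _ _ h.2.2).1⟩, h.2.1, (hP _ _ h.2.2).2⟩, h.2.2⟩,
      fun h => ⟨h.1.1.1, h.1.2.1, h.2⟩⟩
  have h4 : Nat.card {x : ℤ × ℤ // P x.1.natAbs x.2.natAbs}
      = ∑ m ∈ Finset.Icc (-(N : ℤ)) N, ∑ n ∈ Finset.Icc (-(N : ℤ)) N,
        if P m.natAbs n.natAbs then 1 else 0 := by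
    rw [← Finset.sum_product' _ _ (fun m n : ℤ => if P m.natAbs n.natAbs then 1 else 0),
      ← Finset.card_filter]
    refine Nat.subtype_card _ fun x => ?_
    simp only [Finset.mem_filter, Finset.mem_product, Finset.mem_Icc, and_iff_right_iff_imp]
    intro h
    have := hP _ _ h
    lia
  rw [h0, h1, h2, h3, h4]
  rw [Finset.sum_congr rfl fun m _ =>
      sum_Icc_natAbs (fun j => if P (Int.natAbs m) j then 1 else 0) N,
    sum_Icc_natAbs (fun i => (if P i 0 then 1 else 0)
    + 2 * ∑ j ∈ Finset.Icc 1 N, if P i j then 1 else 0), Finset.sum_add_distrib,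
    ← Finset.mul_sum]
  ring

theorem finite_natAbs {P : ℕ → ℕ → Prop} (N : ℕ) (hP : ∀ i j, P i j → i ≤ N ∧ j ≤ N) :
    Finite {x : ℤ × ℤ // P x.1.natAbs x.2.natAbs} := by
  refine ((Finset.Icc (-(N : ℤ)) N ×ˢ Finset.Icc (-(N : ℤ)) N).finite_toSet.subset
    fun x hx => ?_ : {x : ℤ × ℤ | P x.1.natAbs x.2.natAbs}.Finite)
  have := hP _ _ hx
  simp only [Finset.coe_product, Set.mem_prod, Finset.coe_Icc, Set.mem_Icc]
  lia

end counting

/-! ### The eigenbasis of the iterated Jacobi operator -/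

/-- The index set of the eigenbasis: a Fourier mode, and one of the two eigenvalues there. -/
abbrev ModeIndex : Type := (ℤ × ℤ) ⊕ (ℤ × ℤ)

/-- The eigenvalues of `I₂`, listed with multiplicity. -/
def modeEigenvalue (k : ℕ) : ModeIndex → ℝ :=
  Sum.elim (fun x => lambdaPlus k x.1.natAbs x.2.natAbs)
    (fun x => lambdaMinus k x.1.natAbs x.2.natAbs)

/-- The eigenvectors of the symbol of `I₂`. -/
def modeVector (k : ℕ) : ModeIndex → ℝ × ℝ :=
  Sum.elim (fun x => (eigenvectorOne k x.1.natAbs x.2.natAbs, 2 * symbolMixed k x.1 x.2))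
    (fun x => (-(2 * symbolMixed k x.1 x.2), eigenvectorOne k x.1.natAbs x.2.natAbs))

/-- The Fourier mode of an index. -/
def modeFreq : ModeIndex → ℤ × ℤ := Sum.elim id id

/-- The functional that pairs a section with an eigensection of `I₂`. -/
def modeFunctional (k : ℕ) (i : ModeIndex) : Sections (phi k) →ₗ[ℝ] ℝ where
  toFun V := (modeVector k i).1 * coeffOne k (modeFreq i).1 (modeFreq i).2 V
    + (modeVector k i).2 * coeffTwo k (-(modeFreq i).1) (modeFreq i).2 V
  map_add' V W := by
    rw [Submodule.coe_add, coeffOne_add V.2 W.2, coeffTwo_add V.2 W.2]; ring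
  map_smul' c V := by
    rw [Submodule.coe_smul, coeffOne_smul, coeffTwo_smul, RingHom.id_apply, smul_eq_mul]; ring

/-- The eigensections of `I₂`. -/
def eigenSection (k : ℕ) (i : ModeIndex) : Sections (phi k) :=
  ⟨modeSection k (modeFreq i).1 (modeFreq i).2 (modeVector k i).1 (modeVector k i).2,
    isSection_modeSection k _ _ _ _⟩

theorem symbolOne_natAbs (k : ℕ) (m n : ℤ) :
    symbolOne k (m.natAbs : ℝ) (n.natAbs : ℝ) = symbolOne k m n := by
  simp only [symbolOne, Nat.cast_natAbs, Int.cast_abs, sq_abs]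

theorem symbolTwo_natAbs (k : ℕ) (m n : ℤ) :
    symbolTwo k (m.natAbs : ℝ) (n.natAbs : ℝ) = symbolTwo k m n := by
  simp only [symbolTwo, Nat.cast_natAbs, Int.cast_abs, sq_abs]

/-- `symbolMixed` is odd in its first argument, so only its square depends on absolute values alone;
this suffices, since the eigenvalues see only the square. -/
theorem symbolMixed_natAbs_sq (k : ℕ) (m n : ℤ) :
    symbolMixed k (m.natAbs : ℝ) (n.natAbs : ℝ) ^ 2 = symbolMixed k m n ^ 2 := by
  simp only [symbolMixed_sq, Nat.cast_natAbs, Int.cast_abs, sq_abs]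

/-- `symbolTwo` lies strictly below `symbolOne`, hence below `lambdaPlus`. So the chosen eigenvector
is nonzero even where `symbolMixed` vanishes, for instance at $m=0$. -/
theorem eigenvectorOne_pos {k : ℕ} (hk : 1 ≤ k) (m n : ℕ) : 0 < eigenvectorOne k m n := by
  have h := symbolOne_le_lambdaPlus k m n
  have hk' : (0 : ℝ) < k := by exact_mod_cast hk
  have h4 : 0 < (k : ℝ) ^ 4 := by positivity
  have h5 : 0 ≤ (k : ℝ) ^ 2 * ((m : ℝ) ^ 2 + (n : ℝ) ^ 2) := by positivity
  simp only [symbolOne] at h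
  simp only [eigenvectorOne, symbolTwo]
  linarith

theorem modeFunctional_iteratedJacobi (k : ℕ) (i : ModeIndex) (V : Sections (phi k)) :
    modeFunctional k i (iteratedJacobi (phi k) V) = modeEigenvalue k i * modeFunctional k i V := by
  obtain ⟨m, n⟩ | ⟨m, n⟩ := i <;>
  · have hadd := lambda_add k m.natAbs n.natAbs
    have hmul := lambda_mul k m.natAbs n.natAbs
    rw [symbolOne_natAbs, symbolTwo_natAbs] at hadd hmul
    rw [symbolMixed_natAbs_sq] at hmul
    simp only [modeFunctional, iteratedJacobi, modeEigenvalue, modeVector, modeFreq,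
      eigenvectorOne, LinearMap.coe_mk, AddHom.coe_mk, Sum.elim_inl, Sum.elim_inr, id,
      coeffOne_jacobiField V.2, coeffTwo_jacobiField V.2, symbolTwo_natAbs]
    -- After `symbolOne` is eliminated by the trace, the eigenvector equation holds in one slot
    -- identically and in the other by the determinant identity `hmul`.
    generalize coeffOne k m n V = x
    generalize coeffTwo k (-m) n V = y
    generalize symbolMixed k m n = b at *
    generalize symbolTwo k m n = d at *
    have ha : symbolOne k m n = lambdaPlus k m.natAbs n.natAbs
      + lambdaMinus k m.natAbs n.natAbs - d := by linarith
    rw [ha] at hmul ⊢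
    generalize lambdaPlus k m.natAbs n.natAbs = p at *
    generalize lambdaMinus k m.natAbs n.natAbs = q at *
    first
    | linear_combination (2 * x) * hmul
    | linear_combination (-2 * x) * hmul
    | linear_combination (2 * y) * hmul
    | linear_combination (-2 * y) * hmul

theorem modeFunctional_eigenSection_self {k : ℕ} (hk : 1 ≤ k) (i : ModeIndex) :
    modeFunctional k i (eigenSection k i) ≠ 0 := by
  obtain ⟨m, n⟩ | ⟨m, n⟩ := i <;>
  · have h := eigenvectorOne_pos hk m.natAbs n.natAbs
    have hpi := Real.pi_pos
    simp only [modeFunctional, eigenSection, modeVector, modeFreq, LinearMap.coe_mk,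
      AddHom.coe_mk, Sum.elim_inl, Sum.elim_inr, id, coeffOne_modeSection,
      coeffTwo_modeSection, if_true]
    refine ne_of_gt ?_
    have h2 : 0 < (2 * Real.pi) ^ 2 := by positivity
    nlinarith [mul_pos (mul_pos h h) h2, mul_nonneg (sq_nonneg (symbolMixed k m n)) h2.le]

/-- Distinct frequencies are orthogonal; at equal frequency the two vectors of `modeVector` differ
by a quarter turn. -/
theorem modeFunctional_eigenSection_of_ne (k : ℕ) (i j : ModeIndex) (hij : i ≠ j) :
    modeFunctional k i (eigenSection k j) = 0 := by
  simp only [modeFunctional, eigenSection, LinearMap.coe_mk, AddHom.coe_mk,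
    coeffOne_modeSection, coeffTwo_modeSection]
  split_ifs with h
  · obtain x | x := i <;> obtain y | y := j <;>
      simp only [modeFreq, Sum.elim_inl, Sum.elim_inr, id, Prod.mk.eta] at h <;> subst h
    · exact absurd rfl hij
    · simp only [modeVector, Sum.elim_inl, Sum.elim_inr]; ring
    · simp only [modeVector, Sum.elim_inl, Sum.elim_inr]; ring
    · exact absurd rfl hij
  · ring

theorem eq_zero_of_modeFunctional_eq_zero {k : ℕ} (hk : 1 ≤ k) (V : Sections (phi k))
    (hV : ∀ i, modeFunctional k i V = 0) : V = 0 := by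
  have h : ∀ m n, coeffOne k m n V = 0 ∧ coeffTwo k (-m) n V = 0 := by
    intro m n
    have h1 := hV (Sum.inl (m, n))
    have h2 := hV (Sum.inr (m, n))
    simp only [modeFunctional, modeVector, modeFreq, LinearMap.coe_mk, AddHom.coe_mk,
      Sum.elim_inl, Sum.elim_inr, id] at h1 h2
    have hp := eigenvectorOne_pos hk m.natAbs n.natAbs
    generalize eigenvectorOne k m.natAbs n.natAbs = p at *
    generalize 2 * symbolMixed k m n = q at *
    -- The two functionals at one frequency form a 2×2 system with this determinant.
    have hdet : p ^ 2 + q ^ 2 ≠ 0 := by positivity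
    constructor
    · refine (mul_eq_zero.1 ?_).resolve_left hdet
      linear_combination p * h1 - q * h2
    · refine (mul_eq_zero.1 ?_).resolve_left hdet
      linear_combination q * h1 + p * h2
  refine Subtype.ext (IsSection.eq_zero_of_coeff_eq_zero V.2 (fun m n => (h m n).1) fun m n => ?_)
  simpa using (h (-m) n).2

/-! ### Counting the nonpositive eigenvalues: nullity and index -/

theorem finite_modeEigenvalue {k : ℕ} (hk : 1 ≤ k) {P : ℝ → Prop} (hP : ∀ x, P x → x ≤ 0) :
    Finite {i // P (modeEigenvalue k i)} := by
  have h1 : Finite {x : ℤ × ℤ // P (lambdaPlus k x.1.natAbs x.2.natAbs)} := by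
    refine finite_natAbs (P := fun i j => P (lambdaPlus k i j)) 0 fun i j h => ?_
    by_contra hij
    exact absurd (hP _ h) (not_le.2 (lambdaPlus_pos (by lia)))
  have h2 : Finite {x : ℤ × ℤ // P (lambdaMinus k x.1.natAbs x.2.natAbs)} :=
    finite_natAbs (P := fun i j => P (lambdaMinus k i j)) (2 * k) fun i j h =>
      le_of_lambdaMinus_nonpos hk (hP _ h)
  have h3 : Finite ({x : ℤ × ℤ // P (modeEigenvalue k (Sum.inl x))}
      ⊕ {x : ℤ × ℤ // P (modeEigenvalue k (Sum.inr x))}) := @Finite.instSum _ _ h1 h2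
  exact Finite.of_equiv _ (Equiv.subtypeSum (p := fun i => P (modeEigenvalue k i))).symm

/-- The first summand is the only possible contribution of `lambdaPlus`, from the origin, where it
equals 0. The rest is the orbit count for `lambdaMinus`. -/
theorem card_modeEigenvalue {k : ℕ} (hk : 1 ≤ k) {P : ℝ → Prop} (hP : ∀ x, P x → x ≤ 0) :
    Nat.card {i // P (modeEigenvalue k i)} = Set.ncard {i : ℕ | i = 0 ∧ P 0}
      + (Set.ncard {i : ℕ | i = 0 ∧ P (lambdaMinus k 0 0)}
        + 2 * Set.ncard {j | 1 ≤ j ∧ P (lambdaMinus k 0 j)}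
        + 2 * Set.ncard {i | 1 ≤ i ∧ P (lambdaMinus k i 0)}
        + 4 * Set.ncard {q : ℕ × ℕ | 1 ≤ q.1 ∧ 1 ≤ q.2 ∧ P (lambdaMinus k q.1 q.2)}) := by
  have h2 : Finite {x : ℤ × ℤ // P (lambdaMinus k x.1.natAbs x.2.natAbs)} :=
    finite_natAbs (P := fun i j => P (lambdaMinus k i j)) (2 * k) fun i j h =>
      le_of_lambdaMinus_nonpos hk (hP _ h)
  have h0 : ∀ i j, P (lambdaPlus k i j) → i ≤ 0 ∧ j ≤ 0 := by
    intro i j h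
    by_contra hij
    exact absurd (hP _ h) (not_le.2 (lambdaPlus_pos (by lia)))
  have h1 : Finite {x : ℤ × ℤ // P (lambdaPlus k x.1.natAbs x.2.natAbs)} :=
    finite_natAbs (P := fun i j => P (lambdaPlus k i j)) 0 h0
  rw [Nat.card_congr (Equiv.subtypeSum (p := fun i => P (modeEigenvalue k i)))]
  simp only [modeEigenvalue, Sum.elim_inl, Sum.elim_inr]
  rw [Nat.card_sum, card_natAbs (fun i j => P (lambdaPlus k i j)) 0 h0,
    card_natAbs (fun i j => P (lambdaMinus k i j)) (2 * k)
      fun i j h => le_of_lambdaMinus_nonpos hk (hP _ h), lambdaPlus_zero_zero]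
  have e1 : {j : ℕ | 1 ≤ j ∧ P (lambdaPlus k 0 j)} = ∅ := by
    ext j
    simp only [Set.mem_ofPred_eq, Set.mem_empty_iff_false, iff_false]
    rintro ⟨h, h'⟩
    have := h0 _ _ h'
    lia
  have e2 : {i : ℕ | 1 ≤ i ∧ P (lambdaPlus k i 0)} = ∅ := by
    ext j
    simp only [Set.mem_ofPred_eq, Set.mem_empty_iff_false, iff_false]
    rintro ⟨h, h'⟩
    have := h0 _ _ h'
    lia
  have e3 : {q : ℕ × ℕ | 1 ≤ q.1 ∧ 1 ≤ q.2 ∧ P (lambdaPlus k q.1 q.2)} = ∅ := by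
    ext q
    simp only [Set.mem_ofPred_eq, Set.mem_empty_iff_false, iff_false]
    rintro ⟨h, -, h'⟩
    have := h0 _ _ h'
    lia
  rw [e1, e2, e3, Set.ncard_empty, Set.ncard_empty]
  ring

theorem rank_eigenspace_iteratedJacobi {k : ℕ} (hk : 1 ≤ k) {μ : ℝ} (hμ : μ ≤ 0) :
    Module.rank ℝ (Module.End.eigenspace (iteratedJacobi (phi k)) μ)
      = Cardinal.mk {i // modeEigenvalue k i = μ} :=
  rank_eigenspace_of_biorthogonal _ (eigenSection k) (modeFunctional k) (modeEigenvalue k)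
    (modeFunctional_iteratedJacobi k) (modeFunctional_eigenSection_self hk)
    (modeFunctional_eigenSection_of_ne k) (eq_zero_of_modeFunctional_eq_zero hk) μ
    (finite_modeEigenvalue hk (P := fun x => x = μ) fun _ h => h.le.trans hμ)

/-- The 5 is made of `lambdaPlus` at the origin and `lambdaMinus` at $(0,\pm k)$ and $(\pm k,0)$. -/
theorem nullity_phi {k : ℕ} (hk : 1 ≤ k) :
    nullity (phi k) = ((5 + 4 * countZero k : ℕ) : Cardinal) := by
  have hfin := finite_modeEigenvalue hk (P := fun x => x = 0) fun _ h => h.le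
  rw [nullity, ← Module.End.eigenspace_zero, rank_eigenspace_iteratedJacobi hk le_rfl,
    ← Nat.cast_card, card_modeEigenvalue hk (P := fun x => x = 0) fun _ h => h.le]
  congr 1
  have e0 : {i : ℕ | i = 0 ∧ (0 : ℝ) = 0} = {0} := by ext; simp
  have e1 : {i : ℕ | i = 0 ∧ lambdaMinus k 0 0 = 0} = ∅ := by
    ext i
    simp only [Set.mem_ofPred_eq, Set.mem_empty_iff_false, lambdaMinus_zero_left_eq_zero_iff]
    lia
  have e2 : {j : ℕ | 1 ≤ j ∧ lambdaMinus k 0 j = 0} = {k} := by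
    ext j
    simp only [Set.mem_ofPred_eq, Set.mem_singleton_iff, lambdaMinus_zero_left_eq_zero_iff]
    lia
  have e3 : {i : ℕ | 1 ≤ i ∧ lambdaMinus k i 0 = 0} = {k} := by
    ext j
    simp only [Set.mem_ofPred_eq, Set.mem_singleton_iff]
    refine ⟨fun h => (lambdaMinus_zero_right_eq_zero_iff hk h.1).1 h.2, ?_⟩
    rintro rfl
    exact ⟨hk, (lambdaMinus_zero_right_eq_zero_iff hk hk).2 rfl⟩
  rw [e0, e1, e2, e3, Set.ncard_empty, Set.ncard_singleton, Set.ncard_singleton, countZero]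
  ring

/-- The 1 is `lambdaMinus` at the origin, equal to $-k^4$; each axis contributes $2(k-1)$ from
$0<|m|<k$ or $0<|n|<k$. -/
theorem index_phi {k : ℕ} (hk : 1 ≤ k) :
    index (phi k) = ((1 + 4 * (k - 1) + 4 * countNeg k : ℕ) : Cardinal) := by
  have hfin := finite_modeEigenvalue hk (P := fun x => x < 0) fun _ h => h.le
  -- The cardinal sum over all negative reals collapses: the fibres of `modeEigenvalue` partition
  -- the modes with negative eigenvalue.
  let e : (Σ μ : {μ : ℝ // μ < 0}, {i // modeEigenvalue k i = μ})
      ≃ {i // modeEigenvalue k i < 0} :=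
    { toFun := fun x => ⟨x.2.1, x.2.2.trans_lt x.1.2⟩
      invFun := fun i => ⟨⟨_, i.2⟩, i.1, rfl⟩
      left_inv := by
        rintro ⟨⟨μ, hμ⟩, i, hi⟩
        obtain rfl : modeEigenvalue k i = μ := hi
        rfl
      right_inv := fun i => rfl }
  have hsum : index (phi k) = Cardinal.mk {i // modeEigenvalue k i < 0} := by
    rw [← Cardinal.mk_congr e, Cardinal.mk_sigma, index]
    congr 1
    funext μ
    exact rank_eigenspace_iteratedJacobi hk μ.2.le
  rw [hsum, ← Nat.cast_card, card_modeEigenvalue hk (P := fun x => x < 0) fun _ h => h.le]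
  congr 1
  have e0 : {i : ℕ | i = 0 ∧ (0 : ℝ) < 0} = ∅ := by ext; simp
  have e1 : {i : ℕ | i = 0 ∧ lambdaMinus k 0 0 < 0} = {0} := by
    ext i
    simp only [Set.mem_ofPred_eq, Set.mem_singleton_iff, lambdaMinus_zero_left_neg_iff]
    lia
  have e2 : {j : ℕ | 1 ≤ j ∧ lambdaMinus k 0 j < 0} = Finset.Ico 1 k := by
    ext j
    simp only [Set.mem_ofPred_eq, Finset.coe_Ico, Set.mem_Ico, lambdaMinus_zero_left_neg_iff]
  have e3 : {i : ℕ | 1 ≤ i ∧ lambdaMinus k i 0 < 0} = Finset.Ico 1 k := by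
    ext j
    simp only [Set.mem_ofPred_eq, Finset.coe_Ico, Set.mem_Ico]
    exact and_congr_right fun h => lambdaMinus_zero_right_neg_iff hk h
  rw [e0, e1, e2, e3, Set.ncard_empty, Set.ncard_singleton, Set.ncard_coe_finset, Nat.card_Ico,
    countNeg]
  ring

end Biharmonic

end

theorem theorem1p3 (k : ℕ) (hk : 1 ≤ k) :
    Biharmonic.nullity (Biharmonic.phi k) = ((5 + 4 * Biharmonic.countZero k : ℕ) : Cardinal) ∧
    Biharmonic.index (Biharmonic.phi k) =
      ((1 + 4 * (k - 1) + 4 * Biharmonic.countNeg k : ℕ) : Cardinal) :=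
  ⟨Biharmonic.nullity_phi hk, Biharmonic.index_phi hk⟩
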